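/- Let $\eta\approx 0.8105$ be the real root of $X^3+X^2+X-2$ and let $\alpha_0=\frac{\log 2}{\log 2-\log\eta}\approx 0.7674$. For a sequence $\omega=\omega_0\omega_1\omega_2\dots\in\{0,1,2\}^{\mathbb N}$ with shift $\sigma\omega=\omega_1\omega_2\dots$, let $G_\omega=\langle a,b_\omega,c_\omega,d_\omega\rangle$ be the Grigorchuk group of automorphisms of the binary rooted tree $T$: $a$ exchanges the two subtrees below the root (it changes the first letter of a $0$-$1$ word), and, writing $(g_0,g_1)$ for the automorphism that acts as $g_t$ on the subtree below the first-level vertex $t\in\{0,1\}$, $$b_\omega=(u^b(\omega_0),b_{\sigma\omega}),\qquad c_\omega=(u^c(\omega_0),c_{\sigma\omega}),\qquad d_\omega=(u^d(\omega_0),d_{\sigma\omega}),$$ where $u^b(0)=u^b(1)=a$, $u^b(2)=\mathrm{id}$; $u^c(0)=u^c(2)=a$, $u^c(1)=\mathrm{id}$; $u^d(1)=u^d(2)=a$, $u^d(0)=\mathrm{id}$. Let $X\subset\partial T$ be the orbit of the ray $1^\infty$ under $G_\omega$. For a group $F$ let $F\wr_X G_\omega=\big(\bigoplus_X F\big)\rtimes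 G_\omega$ be the permutational wreath product, where $\bigoplus_X F$ is the group of finitely supported functions $X\to F$, on which $G_\omega$ acts by translation of the argument. For a group $\Gamma$ with finite generating set $S$, let $b_{\Gamma,S}(r)$ be the number of elements of $\Gamma$ that are products of at most $r$ elements of $S\cup S^{-1}$. (1) For all real $\alpha,\beta$ with $\alpha_0\le\alpha\le\beta\le 1$ there is a sequence $\omega=\omega(\alpha,\beta)\in\{0,1,2\}^{\mathbb N}$ such that for every nontrivial finite group $F$ the group $G(\alpha,\beta)=F\wr_X G_{\omega}$ is finitely generated and, for every finite generating set $S$ of it, $$\liminf_{r\to\infty}\frac{\log\log b_{G(\alpha,\beta),S}(r)}{\log r}=\alpha\quad\text{and}\quad\limsup_{r\to\infty}\frac{\log\log b_{G(\alpha,\beta),S}(r)}{\log r}=\beta.$$ (2) In particular, for every $\alpha\in[\alpha_0,1]$ there is a sequence $\omega=\omega(\alpha)\in\{0,1,2\}^{\mathbb N}$ such that for every nontrivial finite group $F$ the group $G(\alpha)=F\wr_X G_{\omega}$ is finitely generated and, for every finite generating set $S$ of it, $$\lim_{r\to\infty}\frac{\log\log b_{G(\alpha),S}(r)}{\log r}=\alpha.$$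 -/

import Mathlib

open Filter Topology

/-- The boundary `∂T` of the binary rooted tree `T`: infinite words in the letters
`false` (the letter `0`) and `true` (the letter `1`). -/
abbrev TreeBoundary : Type := ℕ → Bool

/-- The word `t x`: the ray `x` of `T`, placed in the subtree below the first level vertex `t`. -/
def TreeBoundary.cons (t : Bool) (x : TreeBoundary) : TreeBoundary
  | 0 => t
  | n + 1 => x n

/-- The shift of a sequence. -/
def seqShift {A : Type} (x : ℕ → A) : ℕ → A := fun n => x (n + 1)

/-- The map underlying the automorphism `a = (1, 1)ε`: it changes the first letter. -/
def flipFun (x : TreeBoundary) : TreeBoundary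
  | 0 => !(x 0)
  | n + 1 => x (n + 1)

/-- The map underlying the automorphism `v_ω = (u(ω₀), v_{σω})`, where the given `u : Fin 3 → Bool`
says for which letters the automorphism `u(ω₀)` is `a` (the value `true`) or the identity
(the value `false`): the first letter is fixed, the subtree below `1` is acted on by `v_{σω}`
and the subtree below `0` by `u(ω₀)`. -/
def kleinFun (u : Fin 3 → Bool) : (ℕ → Fin 3) → TreeBoundary → ℕ → Bool
  | _, x, 0 => x 0
  | ω, x, n + 1 =>
      if x 0 then kleinFun u (seqShift ω) (seqShift x) n
      else if u (ω 0) then flipFun (seqShift x) n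
      else seqShift x n

theorem flipFun_involutive : Function.Involutive flipFun := by
  intro x
  funext n
  cases n <;> simp [flipFun]

theorem flipFun_cons (t : Bool) (x : TreeBoundary) :
    flipFun (TreeBoundary.cons t x) = TreeBoundary.cons (!t) x := by
  funext n
  cases n <;> rfl

theorem kleinFun_cons_true (u : Fin 3 → Bool) (ω : ℕ → Fin 3) (x : TreeBoundary) :
    kleinFun u ω (TreeBoundary.cons true x)
      = TreeBoundary.cons true (kleinFun u (seqShift ω) x) := by
  funext n
  cases n <;> rfl

theorem kleinFun_cons_false (u : Fin 3 → Bool) (ω : ℕ → Fin 3) (x : TreeBoundary) :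
    kleinFun u ω (TreeBoundary.cons false x)
      = TreeBoundary.cons false (if u (ω 0) then flipFun x else x) := by
  funext n
  cases n with
  | zero => rfl
  | succ n =>
    change (if u (ω 0) then flipFun x n else x n) = (if u (ω 0) then flipFun x else x) n
    split_ifs <;> rfl

theorem TreeBoundary.cons_seqShift (x : TreeBoundary) :
    TreeBoundary.cons (x 0) (seqShift x) = x := by
  funext n
  cases n <;> rfl

theorem kleinFun_involutive (u : Fin 3 → Bool) (ω : ℕ → Fin 3) :
    Function.Involutive (kleinFun u ω) := by
  intro x
  funext n
  induction n generalizing ω x with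
  | zero => rfl
  | succ n ih =>
    rw [← TreeBoundary.cons_seqShift x]
    cases x 0 with
    | true =>
      rw [kleinFun_cons_true, kleinFun_cons_true]
      exact ih _ _
    | false =>
      rw [kleinFun_cons_false, kleinFun_cons_false]
      split_ifs
      · rw [flipFun_involutive]
      · rfl

/-- The automorphism `a`. An automorphism of `T` is given by its (faithful) action on `∂T`. -/
def genA : Equiv.Perm TreeBoundary := flipFun_involutive.toPerm

/-- The automorphism `b_ω = (u^b(ω₀), b_{σω})` with `u^b(0) = u^b(1) = a`, `u^b(2) = id`. -/
def genB (ω : ℕ → Fin 3) : Equiv.Perm TreeBoundary :=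
  (kleinFun_involutive ![true, true, false] ω).toPerm

/-- The automorphism `c_ω = (u^c(ω₀), c_{σω})` with `u^c(0) = u^c(2) = a`, `u^c(1) = id`. -/
def genC (ω : ℕ → Fin 3) : Equiv.Perm TreeBoundary :=
  (kleinFun_involutive ![true, false, true] ω).toPerm

/-- The automorphism `d_ω = (u^d(ω₀), d_{σω})` with `u^d(1) = u^d(2) = a`, `u^d(0) = id`. -/
def genD (ω : ℕ → Fin 3) : Equiv.Perm TreeBoundary :=
  (kleinFun_involutive ![false, true, true] ω).toPerm

/-- The Grigorchuk group `G_ω = ⟨a, b_ω, c_ω, d_ω⟩`. -/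
def grigorchukGroup (ω : ℕ → Fin 3) : Subgroup (Equiv.Perm TreeBoundary) :=
  Subgroup.closure {genA, genB ω, genC ω, genD ω}

/-- The rightmost ray `ρ = 1^∞`. -/
def rightmostRay : TreeBoundary := fun _ => true

/-- The orbit `X` of the rightmost ray under `G_ω`. -/
abbrev rayOrbit (ω : ℕ → Fin 3) : Set TreeBoundary :=
  MulAction.orbit (grigorchukGroup ω) rightmostRay

/-- The group of finitely supported functions `X → F`, with pointwise multiplication. -/
def finSuppFunctions (X F : Type*) [Group F] : Subgroup (X → F) where
  carrier := {φ | {x | φ x ≠ 1}.Finite}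
  one_mem' := by simp
  mul_mem' := by
    intro φ ψ hφ hψ
    refine (Set.Finite.union hφ hψ).subset ?_
    intro x hx
    by_contra h
    simp only [Set.mem_union, Set.mem_ofPred_eq, not_or, not_not] at h
    exact hx (by simp [h.1, h.2])
  inv_mem' := by
    intro φ hφ
    simpa using hφ

theorem finSuppFunctions_translate {X F G : Type*} [Group F] [Group G] [MulAction G X]
    (g : G) (φ : finSuppFunctions X F) :
    (fun x => φ.1 (g⁻¹ • x)) ∈ finSuppFunctions X F := by
  have h : {x | φ.1 x ≠ 1}.Finite := φ.2
  exact h.preimage (MulAction.injective g⁻¹).injOn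

/-- The action of `G` on finitely supported functions by translations,
`(g.φ)(x) = φ(g⁻¹ x)`. In terms of the right action `x g = g⁻¹ x` this reads
`(g.φ)(x) = φ(x g)`. -/
def translateHom (X F G : Type*) [Group F] [Group G] [MulAction G X] :
    G →* MulAut (finSuppFunctions X F) where
  toFun g :=
    { toFun := fun φ => ⟨fun x => φ.1 (g⁻¹ • x), finSuppFunctions_translate g φ⟩
      invFun := fun φ => ⟨fun x => φ.1 (g⁻¹⁻¹ • x), finSuppFunctions_translate g⁻¹ φ⟩
      left_inv := by
        intro φ
        ext x
        simp
      right_inv := by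
        intro φ
        ext x
        simp
      map_mul' := by
        intro φ ψ
        rfl }
  map_one' := by
    ext φ x
    simp
  map_mul' := by
    intro g h
    ext φ x
    simp [mul_smul]

/-- The permutational wreath product `F ≀_X G`: the semidirect product of the group of finitely
supported functions `X → F` with `G`, with `(φ₁ g₁)(φ₂ g₂) = (φ₁ (g₁.φ₂)) (g₁ g₂)`. -/
abbrev PermWreathProduct (F G X : Type*) [Group F] [Group G] [MulAction G X] : Type _ :=
  finSuppFunctions X F ⋊[translateHom X F G] G

/-- The group `Γ_ω = F ≀_X G_ω`, where `X` is the orbit of the rightmost ray under `G_ω`. -/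
abbrev grigorchukWreath (F : Type*) [Group F] (ω : ℕ → Fin 3) : Type _ :=
  PermWreathProduct F (grigorchukGroup ω) (rayOrbit ω)

open scoped Pointwise in
/-- The growth function `b_{Γ,S}(r)`: the number of elements of `Γ` that are products of at most
`r` elements of `S` and inverses of elements of `S`. -/
noncomputable def growthFunction {Γ : Type*} [Group Γ] (S : Set Γ) (r : ℕ) : ℕ :=
  ((insert 1 (S ∪ S⁻¹)) ^ r : Set Γ).ncard

/-- The function `r ↦ log log b_{Γ,S}(r) / log r`. -/
noncomputable def logGrowthRatio {Γ : Type*} [Group Γ] (S : Set Γ) (r : ℕ) : ℝ :=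
  Real.log (Real.log (growthFunction S r)) / Real.log r

/-- `Γ` is finitely generated with lower logarithmic growth exponent `α` and upper logarithmic
growth exponent `β`, for all finite generating sets. The limits are taken in the extended reals,
so that they always exist. -/
def HasLogGrowthExponents (Γ : Type*) [Group Γ] (α β : ℝ) : Prop :=
  Group.FG Γ ∧ ∀ S : Set Γ, S.Finite → Subgroup.closure S = ⊤ →
    liminf (fun r : ℕ => ((logGrowthRatio S r : ℝ) : EReal)) atTop = (α : EReal) ∧
    limsup (fun r : ℕ => ((logGrowthRatio S r : ℝ) : EReal)) atTop = (β : EReal)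

/-- `Γ` is finitely generated with logarithmic growth exponent `α`, for all finite generating
sets. -/
def HasLogGrowthExponent (Γ : Type*) [Group Γ] (α : ℝ) : Prop :=
  Group.FG Γ ∧ ∀ S : Set Γ, S.Finite → Subgroup.closure S = ⊤ →
    Tendsto (fun r : ℕ => logGrowthRatio S r) atTop (𝓝 α)

/-! The sequence `ω` switches between two modes: in one it rotates through 0, 1, 2, in the other it
is constantly 0. With weights on `b`, `c`, `d` adapted to the mode, the two first-level sections of
a word have total weight at most η times (rotating mode) or 1 times (constant mode) the weight of
the word plus one (`wordWeight_wordSection_le`, `rotWeight_contract`). Changing weights when the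
mode changes costs a factor 4. Let N be the number of rotating places and M the number of changes of
mode among the first k places.

Upper bound: an element is determined by its action on the first k levels and by words for its
sections at level k. Counting such codes bounds log b(r) by a constant times 4^M (η^N r + 2^k)
(`length_wordCode_le`, `exists_log_growthFunction_le`).

Lower bound: a word whose inverted orbit has n points can place lamps independently at these points,
which gives at least 2^n elements. The substitution `pairSubst` almost doubles inverted orbits and
multiplies an adapted length by exactly 2/η or 2. Iterating it k times yields 2^k + 1 points from a
word of length at most a constant times 4^M 2^k / η^N (`two_pow_lt_ncard_orbitSet`,
`length_orbitWord_le`, `exists_le_log_growthFunction`).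

The two bounds meet at r ≈ 2^k / η^N, where log b(r) is 2^k up to a factor exp(O(M + 1)). If M =
O(√k), the ratio log log b(r) / log r is log 2 / (log 2 - x log η) + o(1) with x = N/k. This
expression decreases from 1 at x = 0 to α₀ at x = 1, so it remains to let the density N/k oscillate
between the two values that correspond to β and α (`exists_mode_densities`). Neither the lamp group
nor the generating set enters except through constants. -/

namespace GrigorchukGrowth

/-! ### The Klein group and words in the generators -/

/-- The Klein group `{1, b, c, d}`: `some i` is the involution whose section over `0` is trivial at
the letter `i`, so that `some 0 = d`, `some 1 = c`, `some 2 = b`. -/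
abbrev Klein : Type := Option (Fin 3)

/-- Multiplication in the Klein group. -/
def kleinMul : Klein → Klein → Klein
  | none, y => y
  | some i, none => some i
  | some i, some j => if i = j then none else some (-(i + j))

/-- The letters for which the section over `0` of a Klein element is `a`. -/
def kleinBits (x : Klein) : Fin 3 → Bool := fun j =>
  match x with
  | none => false
  | some i => decide (j ≠ i)

theorem kleinBits_kleinMul (x y : Klein) (j : Fin 3) :
    kleinBits (kleinMul x y) j = xor (kleinBits x j) (kleinBits y j) := by
  revert x y j
  decide

/-- The action of a Klein element on the boundary. -/
def kleinAct (ω : ℕ → Fin 3) (x : Klein) : TreeBoundary → TreeBoundary :=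
  kleinFun (kleinBits x) ω

theorem kleinFun_kleinFun (u v : Fin 3 → Bool) (ω : ℕ → Fin 3) (x : TreeBoundary) :
    kleinFun u ω (kleinFun v ω x) = kleinFun (fun i => xor (u i) (v i)) ω x := by
  funext n
  induction n generalizing ω x with
  | zero => rfl
  | succ n ih =>
    rw [← TreeBoundary.cons_seqShift x]
    cases x 0 with
    | true =>
      simp only [kleinFun_cons_true]
      exact ih _ _
    | false =>
      simp only [kleinFun_cons_false]
      cases u (ω 0) <;> cases v (ω 0) <;> simp [flipFun_involutive (seqShift x)]

theorem kleinAct_kleinMul (ω : ℕ → Fin 3) (x y : Klein) (z : TreeBoundary) :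
    kleinAct ω (kleinMul x y) z = kleinAct ω x (kleinAct ω y z) := by
  rw [kleinAct, kleinAct, kleinAct, kleinFun_kleinFun]
  congr 1
  funext j
  exact kleinBits_kleinMul x y j

theorem cons_rightmostRay : TreeBoundary.cons true rightmostRay = rightmostRay := by
  funext n
  cases n <;> rfl

theorem kleinFun_rightmostRay (u : Fin 3 → Bool) (ω : ℕ → Fin 3) :
    kleinFun u ω rightmostRay = rightmostRay := by
  funext n
  induction n generalizing ω with
  | zero => rfl
  | succ n ih =>
    nth_rewrite 1 [← cons_rightmostRay]
    rw [kleinFun_cons_true]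
    exact ih _

theorem kleinFun_eq_rightmostRay_iff (u : Fin 3 → Bool) (ω : ℕ → Fin 3) (x : TreeBoundary) :
    kleinFun u ω x = rightmostRay ↔ x = rightmostRay := by
  nth_rewrite 1 [← kleinFun_rightmostRay u ω]
  exact (kleinFun_involutive u ω).injective.eq_iff

theorem cons_injective (t : Bool) : Function.Injective (TreeBoundary.cons t) := by
  intro x y h
  funext n
  exact congrFun h (n + 1)

theorem cons_true_eq_rightmostRay_iff (x : TreeBoundary) :
    TreeBoundary.cons true x = rightmostRay ↔ x = rightmostRay := by
  nth_rewrite 1 [← cons_rightmostRay]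
  exact (cons_injective true).eq_iff

theorem cons_false_ne_cons_true (x y : TreeBoundary) :
    TreeBoundary.cons false x ≠ TreeBoundary.cons true y := by
  intro h
  have := congrFun h 0
  simp [TreeBoundary.cons] at this

theorem cons_false_ne_rightmostRay (x : TreeBoundary) :
    TreeBoundary.cons false x ≠ rightmostRay := by
  rw [← cons_rightmostRay]
  exact cons_false_ne_cons_true _ _

theorem kleinAct_none (ω : ℕ → Fin 3) (x : TreeBoundary) : kleinAct ω none x = x := by
  funext n
  induction n generalizing ω x with
  | zero => rfl
  | succ n ih =>
    rw [← TreeBoundary.cons_seqShift x, kleinAct]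
    cases x 0 with
    | true =>
      rw [kleinFun_cons_true]
      exact ih _ _
    | false =>
      rw [kleinFun_cons_false]
      rfl

/-- Letters: `none` is the generator `a` and `some (x, f)` is the product of the Klein element `x`
and the element `f` of the lamp group placed at the rightmost ray. -/
abbrev Letter (F : Type*) : Type _ := Option (Klein × F)

section Words

variable {F : Type*} [Group F]

set_option linter.unusedSectionVars false

open Classical in
/-- The function supported at the rightmost ray with value `h`. -/
noncomputable def lampAt (h : F) (x : TreeBoundary) : F := if x = rightmostRay then h else 1

@[simp] theorem lampAt_one (x : TreeBoundary) : lampAt (1 : F) x = 1 := by simp [lampAt]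

theorem lampAt_mul (h k : F) (x : TreeBoundary) : lampAt (h * k) x = lampAt h x * lampAt k x := by
  unfold lampAt
  split_ifs <;> simp

theorem lampAt_kleinFun (h : F) (u : Fin 3 → Bool) (ω : ℕ → Fin 3) (x : TreeBoundary) :
    lampAt h (kleinFun u ω x) = lampAt h x := by
  by_cases hx : x = rightmostRay
  · rw [lampAt, lampAt, if_pos ((kleinFun_eq_rightmostRay_iff u ω x).2 hx), if_pos hx]
  · rw [lampAt, lampAt, if_neg (mt (kleinFun_eq_rightmostRay_iff u ω x).1 hx), if_neg hx]

theorem lampAt_cons_true (h : F) (x : TreeBoundary) :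
    lampAt h (TreeBoundary.cons true x) = lampAt h x := by
  by_cases hx : x = rightmostRay
  · rw [lampAt, lampAt, if_pos ((cons_true_eq_rightmostRay_iff x).2 hx), if_pos hx]
  · rw [lampAt, lampAt, if_neg (mt (cons_true_eq_rightmostRay_iff x).1 hx), if_neg hx]

theorem lampAt_cons_false (h : F) (x : TreeBoundary) :
    lampAt h (TreeBoundary.cons false x) = 1 := by
  simp [lampAt, cons_false_ne_rightmostRay]

/-- The action of letters on `∂T × F`. -/
noncomputable def letterMap (ω : ℕ → Fin 3) : Letter F → TreeBoundary × F → TreeBoundary × F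
  | none, p => (flipFun p.1, p.2)
  | some e, p => (kleinAct ω e.1 p.1, lampAt e.2 p.1 * p.2)

/-- The action of words on `∂T × F`. -/
noncomputable def wordMap (ω : ℕ → Fin 3) (w : List (Letter F)) (p : TreeBoundary × F) :
    TreeBoundary × F :=
  w.foldr (letterMap ω) p

@[simp] theorem wordMap_nil (ω : ℕ → Fin 3) (p : TreeBoundary × F) : wordMap ω [] p = p := rfl

@[simp] theorem wordMap_cons (ω : ℕ → Fin 3) (s : Letter F) (w : List (Letter F))
    (p : TreeBoundary × F) : wordMap ω (s :: w) p = letterMap ω s (wordMap ω w p) := rfl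

/-- Prepend a letter, merging it with the first letter if both are in the group `Klein × F`. -/
def mergeCons : Letter F → List (Letter F) → List (Letter F)
  | some e, some e' :: l => some (kleinMul e.1 e'.1, e.2 * e'.2) :: l
  | s, l => s :: l

/-- Klein elements fix the ray 1^∞, so they commute with the lamps placed there and adjacent letters
multiply in the direct product of the Klein group and `F`. -/
theorem wordMap_mergeCons (ω : ℕ → Fin 3) (s : Letter F) (l : List (Letter F))
    (p : TreeBoundary × F) : wordMap ω (mergeCons s l) p = letterMap ω s (wordMap ω l p) := by
  rcases s with _ | e
  · rfl
  rcases l with _ | ⟨_ | e', l⟩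
  · rfl
  · rfl
  · simp only [mergeCons, wordMap_cons, letterMap, kleinAct_kleinMul, Prod.mk.injEq, true_and]
    rw [lampAt_mul, kleinAct, lampAt_kleinFun, mul_assoc]

/-- The word is empty or starts with `a`. -/
def HeadFlip : List (Letter F) → Prop
  | some _ :: _ => False
  | _ => True

/-- No two letters of `Klein × F` are adjacent. -/
def Merged : List (Letter F) → Prop
  | [] => True
  | none :: l => Merged l
  | some _ :: l => HeadFlip l ∧ Merged l

theorem merged_mergeCons (s : Letter F) (l : List (Letter F)) (hl : Merged l) :
    Merged (mergeCons s l) := by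
  rcases s with _ | e
  · exact hl
  rcases l with _ | ⟨_ | e', l⟩
  · exact ⟨trivial, trivial⟩
  · exact ⟨trivial, hl⟩
  · exact hl

/-- Whether the word exchanges the two subtrees below the root. -/
def parity : List (Letter F) → Bool
  | [] => false
  | none :: l => !parity l
  | some _ :: l => parity l

/-- The section of a word at the first level vertex `t`, where `i` is the first letter of `ω`. -/
def wordSection (i : Fin 3) (t : Bool) : List (Letter F) → List (Letter F)
  | [] => []
  | none :: l => wordSection i t l
  | some e :: l =>
      if xor t (parity l) then mergeCons (some e) (wordSection i t l)
      else if kleinBits e.1 i then none :: wordSection i t l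
      else wordSection i t l

theorem merged_wordSection (i : Fin 3) (t : Bool) (w : List (Letter F)) :
    Merged (wordSection i t w) := by
  induction w with
  | nil => trivial
  | cons s l ih =>
    rcases s with _ | e
    · exact ih
    · rw [wordSection]
      split_ifs
      · exact merged_mergeCons _ _ ih
      · exact ih
      · exact ih

/-- The last letter acts first, so the parity of the tail tells which subtree a letter meets. The
lamp at 1^∞ is inherited by the section over 1 only. -/
theorem wordMap_cons_boundary (ω : ℕ → Fin 3) (w : List (Letter F)) (t : Bool) (x : TreeBoundary)
    (f : F) :
    wordMap ω w (TreeBoundary.cons t x, f) =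
      (TreeBoundary.cons (xor t (parity w))
        (wordMap (seqShift ω) (wordSection (ω 0) t w) (x, f)).1,
        (wordMap (seqShift ω) (wordSection (ω 0) t w) (x, f)).2) := by
  induction w with
  | nil => simp [parity, wordSection]
  | cons s l ih =>
    rw [wordMap_cons, ih]
    rcases s with _ | e
    · simp [letterMap, flipFun_cons, parity, wordSection]
    · rw [wordSection, parity]
      cases h : xor t (parity l)
      · cases h' : kleinBits e.1 (ω 0) <;>
          simp [letterMap, kleinAct, kleinFun_cons_false, h', lampAt_cons_false]
      · simp [letterMap, kleinAct, kleinFun_cons_true, lampAt_cons_true, wordMap_mergeCons]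

/-- Merge adjacent letters of `Klein × F`. -/
def mergeWord (w : List (Letter F)) : List (Letter F) := w.foldr mergeCons []

theorem merged_mergeWord (w : List (Letter F)) : Merged (mergeWord w) := by
  induction w with
  | nil => trivial
  | cons s l ih => exact merged_mergeCons _ _ ih

theorem wordMap_mergeWord (ω : ℕ → Fin 3) (w : List (Letter F)) (p : TreeBoundary × F) :
    wordMap ω (mergeWord w) p = wordMap ω w p := by
  induction w with
  | nil => rfl
  | cons s l ih =>
    change wordMap ω (mergeCons s (mergeWord l)) p = _
    rw [wordMap_mergeCons, ih, wordMap_cons]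

/-! ### Weights -/

/-- The weight of a letter, where `a` has weight one. -/
def letterWeight (W : Klein → ℝ) : Letter F → ℝ
  | none => 1
  | some e => W e.1

/-- The weight of a word. -/
def wordWeight (W : Klein → ℝ) (w : List (Letter F)) : ℝ := (w.map (letterWeight W)).sum

@[simp] theorem wordWeight_nil (W : Klein → ℝ) : wordWeight W ([] : List (Letter F)) = 0 := rfl

@[simp] theorem wordWeight_cons (W : Klein → ℝ) (s : Letter F) (l : List (Letter F)) :
    wordWeight W (s :: l) = letterWeight W s + wordWeight W l := by
  simp [wordWeight]

theorem wordWeight_mergeCons_le {W : Klein → ℝ}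
    (hW : ∀ x y, W (kleinMul x y) ≤ W x + W y) (s : Letter F) (l : List (Letter F)) :
    wordWeight W (mergeCons s l) ≤ letterWeight W s + wordWeight W l := by
  rcases s with _ | e
  · simp [mergeCons]
  rcases l with _ | ⟨_ | e', l⟩
  · simp [mergeCons]
  · simp [mergeCons]
  · have := hW e.1 e'.1
    simp only [mergeCons, wordWeight_cons, letterWeight]
    linarith

theorem wordWeight_mergeWord_le {W : Klein → ℝ}
    (hW : ∀ x y, W (kleinMul x y) ≤ W x + W y) (l : List (Letter F)) :
    wordWeight W (mergeWord l) ≤ wordWeight W l := by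
  induction l with
  | nil => exact le_rfl
  | cons s l ih =>
    have := wordWeight_mergeCons_le hW s (mergeWord l)
    rw [wordWeight_cons]
    change wordWeight W (mergeCons s (mergeWord l)) ≤ _
    linarith

theorem wordWeight_le_mul {W W' : Klein → ℝ} {K : ℝ} (hK : 1 ≤ K) (h : ∀ x, W x ≤ K * W' x)
    (l : List (Letter F)) : wordWeight W l ≤ K * wordWeight W' l := by
  induction l with
  | nil => simp
  | cons s l ih =>
    have hs : letterWeight W s ≤ K * letterWeight W' s := by
      rcases s with _ | e
      · simpa [letterWeight] using hK
      · exact h e.1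
    simp only [wordWeight_cons]
    linarith

/-- A Klein letter enters one section as itself and the other as `a` or not at all; `hθ` charges
this to the letter together with one `a`. In a merged word each Klein letter has its own `a` before
it, except possibly an initial one, and this missing `a` is the extra 1. -/
theorem wordWeight_wordSection_le {W W' : Klein → ℝ} {θ : ℝ} {i : Fin 3} (hθ0 : 0 ≤ θ)
    (hW' : ∀ x y, W' (kleinMul x y) ≤ W' x + W' y)
    (hθ : ∀ x, W' x + (if kleinBits x i then 1 else 0) ≤ θ * (1 + W x))
    (w : List (Letter F)) (hw : Merged w) :
    wordWeight W' (wordSection i false w) + wordWeight W' (wordSection i true w) ≤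
        θ * (wordWeight W w + 1) ∧
      (HeadFlip w → wordWeight W' (wordSection i false w) + wordWeight W' (wordSection i true w) ≤
        θ * wordWeight W w) := by
  induction w with
  | nil => simp [wordSection, hθ0]
  | cons s l ih =>
    rcases s with _ | e
    · have := (ih hw).1
      simp only [wordSection, wordWeight_cons, letterWeight]
      constructor
      · linarith
      · intro _
        linarith
    · obtain ⟨hl, hm⟩ := hw
      refine ⟨?_, fun h => h.elim⟩
      have := (ih hm).2 hl
      have he := hθ e.1
      have h0 : wordWeight W' (mergeCons (some e) (wordSection i false l)) ≤ W' e.1 + _ :=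
        wordWeight_mergeCons_le hW' (some e) (wordSection i false l)
      have h1 : wordWeight W' (mergeCons (some e) (wordSection i true l)) ≤ W' e.1 + _ :=
        wordWeight_mergeCons_le hW' (some e) (wordSection i true l)
      rw [wordSection, wordSection, wordWeight_cons, letterWeight]
      cases parity l <;> cases hb : kleinBits e.1 i <;>
        simp only [hb, Bool.xor_false, Bool.xor_true, Bool.not_true,
          Bool.not_false, if_true, if_false, Bool.false_eq_true, wordWeight_cons, letterWeight]
          at he ⊢ <;>
        linarith

end Words

/-! ### The root `η` -/

theorem eta_bounds {η : ℝ} (hη : η ^ 3 + η ^ 2 + η - 2 = 0) : 0.8 < η ∧ η < 0.82 := by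
  constructor
  · by_contra! h
    nlinarith [sq_nonneg η, sq_nonneg (η - 0.8), sq_nonneg (η + 1), mul_nonneg (sub_nonneg.2 h) (sq_nonneg η), mul_nonneg (sub_nonneg.2 h) (sq_nonneg (η + 1))]
  · by_contra! h
    nlinarith [sq_nonneg η, mul_nonneg (sub_nonneg.2 h) (sq_nonneg η), mul_nonneg (sub_nonneg.2 h) (sub_nonneg.2 h)]

/-! ### Weights adapted to the rotating and the constant mode -/

/-- The role of a Klein element when `j` is the current letter of the rotation. -/
def kleinRole (j : Fin 3) : Klein → Fin 3
  | none => 0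
  | some i => i - j

/-- The weights for which the rotation contracts words by the factor `η`. -/
noncomputable def rotWeight (η : ℝ) (j : Fin 3) (x : Klein) : ℝ :=
  ![(1 - η) / (1 - η ^ 3), (1 - η ^ 2) / (1 - η ^ 3), η ^ 3 / (1 - η ^ 3)] (kleinRole j x)

theorem rotWeight_bounds {η : ℝ} (hη : η ^ 3 + η ^ 2 + η - 2 = 0) (j : Fin 3) (x : Klein) :
    1 ≤ 4 * rotWeight η j x ∧ rotWeight η j x ≤ 4 := by
  obtain ⟨h1, h2⟩ := eta_bounds hη
  have hD : 0 < 1 - η ^ 3 := by nlinarith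
  rw [rotWeight]
  generalize kleinRole j x = r
  fin_cases r <;> simp only [Fin.zero_eta, Fin.mk_one, Fin.reduceFinMk, Matrix.cons_val] <;>
    rw [← mul_div_assoc, le_div_iff₀ hD, div_le_iff₀ hD] <;> constructor <;> nlinarith

/-- The equation for η says exactly that the weight of role 2 is the sum of the weights of roles 0
and 1. -/
theorem rotWeight_kleinMul_le {η : ℝ} (hη : η ^ 3 + η ^ 2 + η - 2 = 0) (j : Fin 3)
    (x y : Klein) : rotWeight η j (kleinMul x y) ≤ rotWeight η j x + rotWeight η j y := by
  obtain ⟨h1, h2⟩ := eta_bounds hη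
  have hD : 0 < 1 - η ^ 3 := by nlinarith
  -- Twice the weight of role 0 is less than the weight of role 2, so it matters that two factors of
  -- role 0 never multiply to role 2.
  have key : kleinRole j (kleinMul x y) = 2 → kleinRole j x = 2 ∨ kleinRole j y = 2 ∨
      kleinRole j x ≠ kleinRole j y := by
    revert j x y
    decide
  rw [rotWeight, rotWeight, rotWeight]
  generalize kleinRole j (kleinMul x y) = r at *
  generalize kleinRole j x = s at *
  generalize kleinRole j y = t at *
  fin_cases r <;> fin_cases s <;> fin_cases t <;>
    simp only [Fin.zero_eta, Fin.mk_one, Fin.reduceFinMk, Matrix.cons_val, ← add_div] at key ⊢ <;>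
    first
    | exact absurd (key trivial) (by decide)
    | (rw [div_le_div_iff_of_pos_right hD]; nlinarith)

/-- Advancing the rotation moves the roles of nontrivial elements by 0 → 2 → 1 → 0. For these three
the inequality is an equality, and the three equalities determine the weights; only the identity,
which keeps role 0, leaves slack. -/
theorem rotWeight_contract {η : ℝ} (hη : η ^ 3 + η ^ 2 + η - 2 = 0) (j : Fin 3) (x : Klein) :
    rotWeight η (j + 1) x + (if kleinBits x j then 1 else 0) ≤ η * (1 + rotWeight η j x) := by
  obtain ⟨h1, h2⟩ := eta_bounds hη
  have hD : 0 < 1 - η ^ 3 := by nlinarith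
  have key : (kleinRole j x = 0 ∧ kleinBits x j = false ∧
        (kleinRole (j + 1) x = 0 ∨ kleinRole (j + 1) x = 2)) ∨
      (kleinRole j x = 1 ∧ kleinRole (j + 1) x = 0) ∨
      (kleinRole j x = 2 ∧ kleinRole (j + 1) x = 1) := by
    revert j x
    decide
  have hb : (if kleinBits x j then (1 : ℝ) else 0) ≤ 1 := by split_ifs <;> norm_num
  rw [rotWeight, rotWeight]
  rcases key with ⟨h, hb', h' | h'⟩ | ⟨h, h'⟩ | ⟨h, h'⟩
  · simp only [h, h', hb', Matrix.cons_val, Bool.false_eq_true, if_false]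
    field_simp
    nlinarith
  · simp only [h, h', hb', Matrix.cons_val, Bool.false_eq_true, if_false]
    field_simp
    nlinarith
  · simp only [h, h', Matrix.cons_val]
    refine (add_le_add_right hb _).trans ?_
    field_simp
    nlinarith
  · simp only [h, h', Matrix.cons_val]
    refine (add_le_add_right hb _).trans ?_
    field_simp
    nlinarith

/-! ### Modes -/

/-- The sequence that follows the rotation `j, j + 1, j + 2, …` at the places where `T` is true and
is zero at the other places. -/
def modeSeq (T : ℕ → Bool) (j : Fin 3) : ℕ → Fin 3 := fun k =>
  if T k then j + Fin.ofNat 3 k else 0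

/-- The phase advances at the constant places too, so the single parameter `j` carries the recursion
over levels. -/
theorem seqShift_modeSeq (T : ℕ → Bool) (j : Fin 3) :
    seqShift (modeSeq T j) = modeSeq (seqShift T) (j + 1) := by
  funext k
  have h : j + Fin.ofNat 3 (k + 1) = j + 1 + Fin.ofNat 3 k := by
    ext
    simp [Fin.val_add]
    omega
  simp only [seqShift, modeSeq, h]
  rfl

theorem modeSeq_zero_of_true {T : ℕ → Bool} (h : T 0 = true) (j : Fin 3) :
    modeSeq T j 0 = j := by
  simp [modeSeq, h]

theorem modeSeq_zero_of_false {T : ℕ → Bool} (h : T 0 = false) (j : Fin 3) :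
    modeSeq T j 0 = 0 := by
  simp [modeSeq, h]

/-- The number of rotating places among the first `k`. -/
def rotCount : (ℕ → Bool) → ℕ → ℕ
  | _, 0 => 0
  | T, k + 1 => (if T 0 then 1 else 0) + rotCount (seqShift T) k

/-- The number of changes of mode among the first `k` steps. -/
def changeCount : (ℕ → Bool) → ℕ → ℕ
  | _, 0 => 0
  | T, k + 1 => (if T 0 = T 1 then 0 else 1) + changeCount (seqShift T) k

/-- The weights that belong to a mode. -/
noncomputable def modeWeight (η : ℝ) (m : Bool) (j : Fin 3) : Klein → ℝ :=
  if m then rotWeight η j else fun _ => 1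

theorem modeWeight_kleinMul_le {η : ℝ} (hη : η ^ 3 + η ^ 2 + η - 2 = 0) (m : Bool) (j : Fin 3)
    (x y : Klein) :
    modeWeight η m j (kleinMul x y) ≤ modeWeight η m j x + modeWeight η m j y := by
  cases m
  · simp [modeWeight]
  · simpa [modeWeight] using rotWeight_kleinMul_le hη j x y

theorem modeWeight_le {η : ℝ} (hη : η ^ 3 + η ^ 2 + η - 2 = 0) (m m' : Bool) (j : Fin 3)
    (x : Klein) : modeWeight η m j x ≤ 4 ^ (if m' = m then 0 else 1) * modeWeight η m' j x := by
  have := rotWeight_bounds hη j x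
  cases m <;> cases m' <;> simp [modeWeight] <;> linarith

theorem modeWeight_bounds {η : ℝ} (hη : η ^ 3 + η ^ 2 + η - 2 = 0) (m : Bool) (j : Fin 3)
    (x : Klein) : 1 ≤ 4 * modeWeight η m j x ∧ modeWeight η m j x ≤ 4 := by
  have := rotWeight_bounds hη j x
  cases m
  · norm_num [modeWeight]
  · simpa [modeWeight] using this

section Words

variable {F : Type*} [Group F]

set_option linter.unusedSectionVars false

/-- The contraction factor of a mode. -/
noncomputable def modeFactor (η : ℝ) (m : Bool) : ℝ := if m then η else 1

theorem wordWeight_modeWeight_le {η : ℝ} (hη : η ^ 3 + η ^ 2 + η - 2 = 0) (T : ℕ → Bool)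
    (j : Fin 3) (w : List (Letter F)) (hw : Merged w) :
    wordWeight (modeWeight η (T 0) (j + 1)) (wordSection (modeSeq T j 0) false w) +
      wordWeight (modeWeight η (T 0) (j + 1)) (wordSection (modeSeq T j 0) true w) ≤
      modeFactor η (T 0) * (wordWeight (modeWeight η (T 0) j) w + 1) := by
  obtain ⟨h1, h2⟩ := eta_bounds hη
  refine (wordWeight_wordSection_le ?_ (modeWeight_kleinMul_le hη _ _) ?_ w hw).1
  · unfold modeFactor
    split_ifs <;> linarith
  · intro x
    cases h : T 0
    · simp only [modeWeight, modeFactor]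
      split_ifs <;> norm_num at *
    · rw [modeSeq_zero_of_true h]
      simpa [modeWeight, modeFactor] using rotWeight_contract hη j x

/-! ### Encoding words by their sections -/

/-- The alphabet of the codes. -/
abbrev CodeLetter (F : Type*) : Type _ := Option (Letter F) ⊕ Bool

/-- The code of a word: its action on the first `k` levels followed by the sections. -/
def wordCode : ℕ → (ℕ → Fin 3) → List (Letter F) → List (CodeLetter F)
  | 0, _, w => w.map (fun s => Sum.inl (some s)) ++ [Sum.inl none]
  | k + 1, ω, w => Sum.inr (parity w) :: (wordCode k (seqShift ω) (wordSection (ω 0) false w) ++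
      wordCode k (seqShift ω) (wordSection (ω 0) true w))

theorem map_append_separator_inj (w w' : List (Letter F)) (X X' : List (CodeLetter F))
    (h : w.map (fun s => (Sum.inl (some s) : CodeLetter F)) ++ Sum.inl none :: X =
      w'.map (fun s => (Sum.inl (some s) : CodeLetter F)) ++ Sum.inl none :: X') :
    w = w' ∧ X = X' := by
  induction w generalizing w' with
  | nil =>
    cases w' with
    | nil => simpa using h
    | cons s' l' => simp at h
  | cons s l ih =>
    cases w' with
    | nil => simp at h
    | cons s' l' =>
      simp only [List.map_cons, List.cons_append, List.cons.injEq, Sum.inl.injEq,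
        Option.some.injEq] at h
      obtain ⟨h1, h2⟩ := ih l' h.2
      exact ⟨by rw [h.1, h1], h2⟩

/-- The code is self-delimiting up to the action of the word: the arbitrary tails `X`, `X'` let the
induction split the concatenated codes of the two sections. -/
theorem wordMap_eq_of_wordCode_append_eq (k : ℕ) (ω : ℕ → Fin 3) (w w' : List (Letter F))
    (X X' : List (CodeLetter F)) (h : wordCode k ω w ++ X = wordCode k ω w' ++ X') :
    wordMap ω w = wordMap ω w' ∧ X = X' := by
  induction k generalizing ω w w' X X' with
  | zero =>
    obtain ⟨h1, h2⟩ := map_append_separator_inj w w' X X' (by simpa [wordCode] using h)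
    exact ⟨by rw [h1], h2⟩
  | succ k ih =>
    simp only [wordCode, List.cons_append, List.cons.injEq, Sum.inr.injEq, List.append_assoc] at h
    obtain ⟨hp, h⟩ := h
    obtain ⟨h0, h⟩ := ih _ _ _ _ _ h
    obtain ⟨h1, h⟩ := ih _ _ _ _ _ h
    refine ⟨?_, h⟩
    funext ⟨x, f⟩
    rw [← TreeBoundary.cons_seqShift x, wordMap_cons_boundary, wordMap_cons_boundary, hp]
    cases x 0
    · rw [h0]
    · rw [h1]

/-- The term 3 * 2^k - 2 solves s(0) = 1, s(k + 1) = 2 s(k) + 2: a separator at the bottom, and at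
each vertex above it one parity mark and the additive error of the contraction. The additional
factor 4 turns weights, which are at least 1/4 per letter, into lengths. -/
theorem length_wordCode_le {η : ℝ} (hη : η ^ 3 + η ^ 2 + η - 2 = 0) (k : ℕ) (T : ℕ → Bool)
    (j : Fin 3) (w : List (Letter F)) (hw : Merged w) :
    ((wordCode k (modeSeq T j) w).length : ℝ) ≤ 4 ^ (changeCount T k + 1) *
      (η ^ rotCount T k * wordWeight (modeWeight η (T 0) j) w + (3 * 2 ^ k - 2)) := by
  obtain ⟨h1, h2⟩ := eta_bounds hη
  induction k generalizing T j w with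
  | zero =>
    have := wordWeight_le_mul (W := fun _ => 1) (W' := modeWeight η (T 0) j) (K := 4)
      (by norm_num) (fun x => (modeWeight_bounds hη _ _ x).1) w
    have hl : wordWeight (fun _ => 1) w = w.length := by
      clear hw this
      induction w with
      | nil => simp
      | cons s l ih =>
        rw [wordWeight_cons, ih]
        rcases s with _ | e <;> simp [letterWeight] <;> ring
    simp only [wordCode, changeCount, rotCount, List.length_append, List.length_map,
      List.length_singleton]
    push_cast
    linarith
  | succ k ih =>
    have e0 := ih (seqShift T) (j + 1) _ (merged_wordSection (modeSeq T j 0) false w)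
    have e1 := ih (seqShift T) (j + 1) _ (merged_wordSection (modeSeq T j 0) true w)
    have hc := wordWeight_modeWeight_le hη T j w hw
    set c : ℕ := if T 0 = T 1 then 0 else 1 with hcdef
    have hs : (seqShift T) 0 = T 1 := rfl
    have hK : (1 : ℝ) ≤ 4 ^ c := one_le_pow₀ (by norm_num)
    have conv := fun v : List (Letter F) => wordWeight_le_mul hK
      (fun x => modeWeight_le hη (T 1) (T 0) (j + 1) x) v
    rw [hs] at e0 e1
    set A := wordSection (modeSeq T j 0) false w
    set B := wordSection (modeSeq T j 0) true w
    set M := changeCount (seqShift T) k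
    set N := rotCount (seqShift T) k
    have hpos : ∀ v : List (Letter F), 0 ≤ wordWeight (modeWeight η (T 0) j) v := by
      intro v
      refine List.sum_nonneg ?_
      intro x hx
      obtain ⟨s, -, rfl⟩ := List.mem_map.1 hx
      rcases s with _ | e
      · simp [letterWeight]
      · have := (modeWeight_bounds hη (T 0) j e.1).1
        simp only [letterWeight]
        linarith
    have hηN : 0 < η ^ N := pow_pos (by linarith) _
    have hηN1 : η ^ N ≤ 1 := pow_le_one₀ (by linarith) (by linarith)
    have hf : modeFactor η (T 0) ≤ 1 := by
      unfold modeFactor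
      split_ifs <;> linarith
    have hf' : η ^ N * modeFactor η (T 0) = η ^ rotCount T (k + 1) := by
      rw [rotCount, modeFactor]
      split_ifs
      · rw [pow_add, pow_one, mul_comm]
      · rw [zero_add, mul_one]
    have hKM : (1 : ℝ) ≤ 4 ^ (M + 1) := one_le_pow₀ (by norm_num)
    have h2k : (1 : ℝ) ≤ 2 ^ k := one_le_pow₀ (by norm_num)
    have hlen : ((wordCode (k + 1) (modeSeq T j) w).length : ℝ) =
        1 + (wordCode k (modeSeq (seqShift T) (j + 1)) A).length +
          (wordCode k (modeSeq (seqShift T) (j + 1)) B).length := by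
      simp only [wordCode, List.length_cons, List.length_append, seqShift_modeSeq]
      push_cast
      ring
    have hch : (4 : ℝ) ^ (changeCount T (k + 1) + 1) = 4 ^ c * 4 ^ (M + 1) := by
      rw [changeCount, ← pow_add]
      congr 1
    rw [hlen, hch, ← hf']
    have hw0 := hpos w
    set x := wordWeight (modeWeight η (T 0) j) w
    have hAB : wordWeight (modeWeight η (T 1) (j + 1)) A + wordWeight (modeWeight η (T 1) (j + 1)) B
        ≤ 4 ^ c * (modeFactor η (T 0) * (x + 1)) := by
      have := mul_le_mul_of_nonneg_left hc (zero_le_one.trans hK)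
      linarith [conv A, conv B]
    have step1 : η ^ N * (wordWeight (modeWeight η (T 1) (j + 1)) A +
        wordWeight (modeWeight η (T 1) (j + 1)) B) ≤
        4 ^ c * (η ^ N * modeFactor η (T 0) * x + 1) := by
      refine (mul_le_mul_of_nonneg_left hAB hηN.le).trans ?_
      have : η ^ N * modeFactor η (T 0) ≤ 1 := by
        have := mul_le_mul hηN1 hf (by unfold modeFactor; split_ifs <;> linarith) zero_le_one
        linarith
      have := mul_le_mul_of_nonneg_left this (zero_le_one.trans hK)
      linarith
    calc _ ≤ 1 + 4 ^ (M + 1) * (η ^ N * (wordWeight (modeWeight η (T 1) (j + 1)) A +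
        wordWeight (modeWeight η (T 1) (j + 1)) B) + 2 * (3 * 2 ^ k - 2)) := by linarith
      _ ≤ 4 ^ (M + 1) * (4 ^ c * (η ^ N * modeFactor η (T 0) * x + 1) + 2 * (3 * 2 ^ k - 2) + 1) := by
        nlinarith
      _ ≤ 4 ^ (M + 1) * (4 ^ c * (η ^ N * modeFactor η (T 0) * x + (3 * 2 ^ (k + 1) - 2))) := by
        refine mul_le_mul_of_nonneg_left ?_ (by linarith)
        rw [pow_succ]
        nlinarith
      _ = _ := by ring

end Words

section Wreath

variable {F : Type*} [Group F]

set_option linter.unusedSectionVars false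

/-! ### The action of the wreath product on `∂T × F` -/

open Classical in
/-- Extension of a function on the orbit of the rightmost ray by the value one. -/
noncomputable def extendLamps {ω : ℕ → Fin 3} (φ : finSuppFunctions (rayOrbit ω) F)
    (y : TreeBoundary) : F :=
  if h : y ∈ rayOrbit ω then φ.1 ⟨y, h⟩ else 1

/-- The action of the wreath product on `∂T × F`. -/
noncomputable def wreathMap {ω : ℕ → Fin 3} (γ : grigorchukWreath F ω) (p : TreeBoundary × F) :
    TreeBoundary × F :=
  (γ.right.1 p.1, extendLamps γ.left (γ.right.1 p.1) * p.2)

theorem extendLamps_coe {ω : ℕ → Fin 3} (φ : finSuppFunctions (rayOrbit ω) F) (y : rayOrbit ω) :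
    extendLamps φ y.1 = φ.1 y := by
  simp only [extendLamps, Subtype.coe_prop, dif_pos]

theorem extendLamps_of_notMem {ω : ℕ → Fin 3} (φ : finSuppFunctions (rayOrbit ω) F)
    {y : TreeBoundary} (hy : y ∉ rayOrbit ω) : extendLamps φ y = 1 := by
  simp only [extendLamps, hy, dif_neg, not_false_eq_true]

theorem smul_mem_rayOrbit_iff {ω : ℕ → Fin 3} (g : grigorchukGroup ω) (y : TreeBoundary) :
    g.1 y ∈ rayOrbit ω ↔ y ∈ rayOrbit ω :=
  ⟨fun h => by
    obtain ⟨k, hk⟩ := h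
    refine ⟨g⁻¹ * k, ?_⟩
    change (g⁻¹ * k) • rightmostRay = y
    rw [mul_smul, inv_smul_eq_iff]
    exact hk, fun h => by
    obtain ⟨k, hk⟩ := h
    refine ⟨g * k, ?_⟩
    change (g * k) • rightmostRay = g • y
    rw [mul_smul]
    exact congrArg (g • ·) hk⟩

theorem extendLamps_translate {ω : ℕ → Fin 3} (g : grigorchukGroup ω)
    (φ : finSuppFunctions (rayOrbit ω) F) (y : TreeBoundary) :
    extendLamps (translateHom (rayOrbit ω) F (grigorchukGroup ω) g φ) (g.1 y) =
      extendLamps φ y := by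
  by_cases hy : y ∈ rayOrbit ω
  · have hy' : g.1 y ∈ rayOrbit ω := (smul_mem_rayOrbit_iff g y).2 hy
    have h1 := extendLamps_coe φ ⟨y, hy⟩
    have h2 := extendLamps_coe (translateHom (rayOrbit ω) F (grigorchukGroup ω) g φ) ⟨_, hy'⟩
    rw [h1, h2]
    change φ.1 (g⁻¹ • (⟨g.1 y, hy'⟩ : rayOrbit ω)) = _
    refine congrArg φ.1 ?_
    exact (inv_smul_eq_iff (g := g) (a := (⟨g.1 y, hy'⟩ : rayOrbit ω)) (b := ⟨y, hy⟩)).2 rfl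
  · rw [extendLamps_of_notMem _ hy, extendLamps_of_notMem _ (mt (smul_mem_rayOrbit_iff g y).1 hy)]

theorem extendLamps_mul {ω : ℕ → Fin 3} (φ ψ : finSuppFunctions (rayOrbit ω) F)
    (y : TreeBoundary) : extendLamps (φ * ψ) y = extendLamps φ y * extendLamps ψ y := by
  by_cases hy : y ∈ rayOrbit ω
  · exact (extendLamps_coe (φ * ψ) ⟨y, hy⟩).trans
      (congrArg₂ _ (extendLamps_coe φ ⟨y, hy⟩) (extendLamps_coe ψ ⟨y, hy⟩)).symm
  · simp only [extendLamps_of_notMem _ hy, mul_one]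

theorem wreathMap_mul {ω : ℕ → Fin 3} (γ δ : grigorchukWreath F ω) (p : TreeBoundary × F) :
    wreathMap (γ * δ) p = wreathMap γ (wreathMap δ p) := by
  simp only [wreathMap, SemidirectProduct.mul_left, SemidirectProduct.mul_right, extendLamps_mul,
    Subgroup.coe_mul, Equiv.Perm.mul_apply, extendLamps_translate, mul_assoc]

theorem extendLamps_one {ω : ℕ → Fin 3} (y : TreeBoundary) :
    extendLamps (1 : finSuppFunctions (rayOrbit ω) F) y = 1 := by
  by_cases hy : y ∈ rayOrbit ω
  · exact extendLamps_coe 1 ⟨y, hy⟩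
  · exact extendLamps_of_notMem _ hy

theorem wreathMap_one {ω : ℕ → Fin 3} (p : TreeBoundary × F) :
    wreathMap (1 : grigorchukWreath F ω) p = p := by
  simp [wreathMap, extendLamps_one]

/-- The first coordinate recovers the group element, and the second, evaluated over the preimage of
y, recovers the lamp at y. -/
theorem wreathMap_injective {ω : ℕ → Fin 3} :
    Function.Injective (wreathMap : grigorchukWreath F ω → TreeBoundary × F → TreeBoundary × F) := by
  intro γ δ h
  have hr : γ.right = δ.right := by
    ext x : 2
    exact congrArg Prod.fst (congrFun h (x, 1))
  refine SemidirectProduct.ext ?_ hr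
  ext y
  have := congrArg Prod.snd (congrFun h (δ.right.1.symm y.1, 1))
  simpa [wreathMap, hr, extendLamps_coe] using this

/-! ### Letters as elements of the wreath product -/

/-- The generator `a` as an element of the Grigorchuk group. -/
def flipElt (ω : ℕ → Fin 3) : grigorchukGroup ω :=
  ⟨genA, Subgroup.subset_closure (by simp)⟩

theorem kleinPerm_mem (ω : ℕ → Fin 3) (x : Klein) :
    (kleinFun_involutive (kleinBits x) ω).toPerm ∈ grigorchukGroup ω := by
  rcases x with _ | i
  · convert (grigorchukGroup ω).one_mem
    ext z : 1
    exact kleinAct_none ω z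
  · have h0 : kleinBits (some 0) = ![false, true, true] := by decide
    have h1 : kleinBits (some 1) = ![true, false, true] := by decide
    have h2 : kleinBits (some 2) = ![true, true, false] := by decide
    fin_cases i
    · simp only [Fin.zero_eta, h0]
      exact Subgroup.subset_closure (by simp [genD])
    · simp only [Fin.mk_one, h1]
      exact Subgroup.subset_closure (by simp [genC])
    · simp only [Fin.reduceFinMk, h2]
      exact Subgroup.subset_closure (by simp [genB])

/-- A Klein element as an element of the Grigorchuk group. -/
def kleinElt (ω : ℕ → Fin 3) (x : Klein) : grigorchukGroup ω :=
  ⟨(kleinFun_involutive (kleinBits x) ω).toPerm, kleinPerm_mem ω x⟩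

/-- The rightmost ray as a point of its orbit. -/
def rayBase (ω : ℕ → Fin 3) : rayOrbit ω := ⟨rightmostRay, MulAction.mem_orbit_self _⟩

open Classical in
/-- The function supported at one point of the orbit. -/
noncomputable def lampElt {ω : ℕ → Fin 3} (y : rayOrbit ω) (h : F) :
    finSuppFunctions (rayOrbit ω) F :=
  ⟨fun x => if x = y then h else 1, (Set.finite_singleton y).subset fun x hx => by
    by_contra hne
    exact hx (if_neg hne)⟩

theorem lampElt_self {ω : ℕ → Fin 3} (y : rayOrbit ω) (h : F) : (lampElt y h).1 y = h :=
  if_pos rfl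

theorem lampElt_of_ne {ω : ℕ → Fin 3} {x y : rayOrbit ω} (hx : x ≠ y) (h : F) :
    (lampElt y h).1 x = 1 :=
  if_neg hx

theorem extendLamps_lampElt_rayBase {ω : ℕ → Fin 3} (h : F) (x : TreeBoundary) :
    extendLamps (lampElt (rayBase ω) h) x = lampAt h x := by
  by_cases hx : x = rightmostRay
  · have := extendLamps_coe (lampElt (rayBase ω) h) (rayBase ω)
    subst hx
    rw [lampAt, if_pos rfl]
    exact this.trans (lampElt_self _ h)
  · rw [lampAt, if_neg hx]
    by_cases hy : x ∈ rayOrbit ω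
    · refine (extendLamps_coe (lampElt (rayBase ω) h) ⟨x, hy⟩).trans ?_
      exact lampElt_of_ne (fun e => hx (congrArg Subtype.val e)) h
    · exact extendLamps_of_notMem _ hy

/-- A letter as an element of the wreath product. -/
noncomputable def letterElt (ω : ℕ → Fin 3) : Letter F → grigorchukWreath F ω
  | none => SemidirectProduct.inr (flipElt ω)
  | some e => SemidirectProduct.inl (lampElt (rayBase ω) e.2) *
      SemidirectProduct.inr (kleinElt ω e.1)

theorem wreathMap_letterElt (ω : ℕ → Fin 3) (s : Letter F) (p : TreeBoundary × F) :
    wreathMap (letterElt ω s) p = letterMap ω s p := by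
  rcases s with _ | e
  · simp only [wreathMap, letterElt, SemidirectProduct.left_inr, SemidirectProduct.right_inr,
      extendLamps_one, one_mul, letterMap]
    rfl
  · rw [letterElt, wreathMap_mul]
    simp only [wreathMap, SemidirectProduct.left_inr, SemidirectProduct.right_inr,
      SemidirectProduct.left_inl, SemidirectProduct.right_inl, extendLamps_one, one_mul, letterMap,
      Subgroup.coe_one, Equiv.Perm.coe_one, id_eq, extendLamps_lampElt_rayBase]
    have : (kleinElt ω e.1).1 p.1 = kleinFun (kleinBits e.1) ω p.1 := rfl
    rw [this, lampAt_kleinFun]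
    rfl

/-- The element of the wreath product given by a word. -/
noncomputable def wordElt (ω : ℕ → Fin 3) (w : List (Letter F)) : grigorchukWreath F ω :=
  (w.map (letterElt ω)).prod

theorem wordElt_append (ω : ℕ → Fin 3) (v w : List (Letter F)) :
    wordElt ω (v ++ w) = wordElt ω v * wordElt ω w := by
  simp [wordElt]

theorem wreathMap_wordElt (ω : ℕ → Fin 3) (w : List (Letter F)) (p : TreeBoundary × F) :
    wreathMap (wordElt ω w) p = wordMap ω w p := by
  induction w with
  | nil => exact wreathMap_one p
  | cons s l ih =>
    rw [wordMap_cons, ← ih, ← wreathMap_letterElt, ← wreathMap_mul]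
    simp [wordElt]

/-- Conjugation carries the lamps at 1^∞ to every point of its orbit, and finitely supported
functions are finite products of lamps. -/
theorem closure_range_letterElt (ω : ℕ → Fin 3) :
    Subgroup.closure (Set.range (letterElt (F := F) ω)) = ⊤ := by
  set H := Subgroup.closure (Set.range (letterElt (F := F) ω)) with hH
  have hlet : ∀ s, letterElt ω s ∈ H := fun s => Subgroup.subset_closure ⟨s, rfl⟩
  have hlamp1 : ∀ e : Klein × F, letterElt ω (some e) = SemidirectProduct.inl
      (lampElt (rayBase ω) e.2) * SemidirectProduct.inr (kleinElt ω e.1) := fun e => rfl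
  have hone : lampElt (rayBase ω) (1 : F) = 1 := by
    ext x
    simp [lampElt]
  have hk : ∀ x : Klein, SemidirectProduct.inr (kleinElt ω x) ∈ H := by
    intro x
    have := hlet (some (x, 1))
    rwa [hlamp1, hone, map_one, one_mul] at this
  have hρ : ∀ h : F, SemidirectProduct.inl (lampElt (rayBase ω) h) ∈ H := by
    intro h
    have := H.mul_mem (hlet (some (none, h))) (H.inv_mem (hk none))
    rwa [hlamp1, mul_inv_cancel_right] at this
  have hG : ∀ g : grigorchukGroup ω, SemidirectProduct.inr g ∈ H := by
    rintro ⟨g, hg⟩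
    induction hg using Subgroup.closure_induction with
    | mem x hx =>
      simp only [Set.mem_insert_iff, Set.mem_singleton_iff] at hx
      rcases hx with rfl | rfl | rfl | rfl
      · exact hlet none
      · convert hk (some 2) using 2
        ext z : 2
        change kleinFun _ ω z = kleinFun _ ω z
        congr 1
        decide
      · convert hk (some 1) using 2
        ext z : 2
        change kleinFun _ ω z = kleinFun _ ω z
        congr 1
        decide
      · convert hk (some 0) using 2
        ext z : 2
        change kleinFun _ ω z = kleinFun _ ω z
        congr 1
        decide
    | one => exact (map_one (SemidirectProduct.inr
        (φ := translateHom (rayOrbit ω) F (grigorchukGroup ω)))).symm ▸ H.one_mem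
    | mul x y hx hy ihx ihy =>
      have := H.mul_mem ihx ihy
      rwa [← map_mul] at this
    | inv x hx ih =>
      have := H.inv_mem ih
      rwa [← map_inv] at this
  have hlamp : ∀ (y : rayOrbit ω) (h : F), SemidirectProduct.inl (lampElt y h) ∈ H := by
    rintro ⟨_, g, rfl⟩ h
    have h1 := H.mul_mem (H.mul_mem (hG g) (hρ h)) (H.inv_mem (hG g))
    rw [← map_inv, ← SemidirectProduct.inl_aut] at h1
    convert h1 using 2
    ext x
    change (lampElt _ h).1 x = (lampElt (rayBase ω) h).1 (g⁻¹ • x)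
    by_cases hx : g⁻¹ • x = rayBase ω
    · have : x = g • rayBase ω := inv_smul_eq_iff.1 hx
      rw [hx, lampElt_self, this]
      exact lampElt_self (g • rayBase ω) h
    · rw [lampElt_of_ne hx, lampElt_of_ne]
      rintro rfl
      exact hx (inv_smul_eq_iff.2 rfl)
  have hfin : ∀ s : Set (rayOrbit ω), s.Finite → ∀ φ : finSuppFunctions (rayOrbit ω) F,
      (∀ x, φ.1 x ≠ 1 → x ∈ s) → SemidirectProduct.inl φ ∈ H := by
    intro s hs
    induction s, hs using Set.Finite.induction_on with
    | empty =>
      intro φ hφ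
      have : φ = 1 := by
        ext x
        by_contra h
        exact hφ x h
      rw [this, map_one]
      exact H.one_mem
    | @insert y s hy hs ih =>
      intro φ hφ
      have h1 := ih ((lampElt y (φ.1 y))⁻¹ * φ) (by
        intro x hx
        have hx' : ((lampElt y (φ.1 y)).1 x)⁻¹ * φ.1 x ≠ 1 := hx
        by_cases hxy : x = y
        · subst hxy
          rw [lampElt_self, inv_mul_cancel] at hx'
          exact (hx' rfl).elim
        · rw [lampElt_of_ne hxy, inv_one, one_mul] at hx'
          exact (hφ x hx').resolve_left hxy)
      have h2 := H.mul_mem (hlamp y (φ.1 y)) h1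
      rwa [← map_mul, mul_inv_cancel_left] at h2
  rw [eq_top_iff]
  rintro γ -
  rw [← SemidirectProduct.inl_left_mul_inr_right γ]
  exact H.mul_mem (hfin _ γ.left.2 _ fun x hx => hx) (hG _)

theorem kleinMul_self (x : Klein) : kleinMul x x = none := by
  revert x
  decide

theorem letterElt_inv (ω : ℕ → Fin 3) (s : Letter F) :
    ∃ s', (letterElt ω s)⁻¹ = letterElt ω s' := by
  have key : ∀ s s' : Letter F, (∀ p, letterMap ω s (letterMap ω s' p) = p) →
      (letterElt ω s)⁻¹ = letterElt ω s' := by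
    intro s s' h
    rw [inv_eq_iff_mul_eq_one]
    apply wreathMap_injective
    funext p
    rw [wreathMap_mul, wreathMap_letterElt, wreathMap_letterElt, h, wreathMap_one]
  rcases s with _ | e
  · refine ⟨none, key _ _ fun p => ?_⟩
    simp [letterMap, flipFun_involutive p.1]
  · refine ⟨some (e.1, e.2⁻¹), key _ _ fun p => ?_⟩
    simp only [letterMap]
    rw [← kleinAct_kleinMul, kleinMul_self, kleinAct_none, kleinAct, lampAt_kleinFun,
      ← mul_assoc, ← lampAt_mul, mul_inv_cancel, lampAt_one, one_mul]

theorem wordElt_surjective (ω : ℕ → Fin 3) :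
    Function.Surjective (wordElt (F := F) ω) := by
  intro γ
  have hγ : γ ∈ Subgroup.closure (Set.range (letterElt (F := F) ω)) := by
    rw [closure_range_letterElt]
    trivial
  induction hγ using Subgroup.closure_induction with
  | mem x hx =>
    obtain ⟨s, rfl⟩ := hx
    exact ⟨[s], by simp [wordElt]⟩
  | one => exact ⟨[], rfl⟩
  | mul x y hx hy ihx ihy =>
    obtain ⟨v, rfl⟩ := ihx
    obtain ⟨w, rfl⟩ := ihy
    exact ⟨v ++ w, wordElt_append ω v w⟩
  | inv x hx ih =>
    obtain ⟨w, rfl⟩ := ih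
    clear hx
    induction w with
    | nil => exact ⟨[], by simp [wordElt]⟩
    | cons s l ih =>
      obtain ⟨w', hw'⟩ := ih
      obtain ⟨s', hs'⟩ := letterElt_inv ω s
      refine ⟨w' ++ [s'], ?_⟩
      rw [wordElt_append, hw']
      simp [wordElt, hs']

theorem fg_grigorchukWreath [Finite F] (ω : ℕ → Fin 3) : Group.FG (grigorchukWreath F ω) :=
  Group.fg_iff.2 ⟨_, closure_range_letterElt ω, Set.finite_range _⟩

end Wreath

/-! ### Growth of groups -/

section Growth

open scoped Pointwise

variable {Γ : Type*} [Group Γ]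

theorem finite_ball {S : Set Γ} (hS : S.Finite) (r : ℕ) :
    ((insert 1 (S ∪ S⁻¹)) ^ r : Set Γ).Finite := by
  induction r with
  | zero => simp
  | succ r ih =>
    rw [pow_succ]
    exact ih.mul ((hS.union hS.inv).insert 1)

theorem ball_subset_ball {S : Set Γ} {m n : ℕ} (h : m ≤ n) :
    (insert 1 (S ∪ S⁻¹) : Set Γ) ^ m ⊆ (insert 1 (S ∪ S⁻¹)) ^ n :=
  Set.pow_subset_pow_right (Set.mem_insert 1 _) h

theorem exists_mem_ball {S : Set Γ} (hS : Subgroup.closure S = ⊤) (γ : Γ) :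
    ∃ n, γ ∈ (insert 1 (S ∪ S⁻¹) : Set Γ) ^ n := by
  have hγ : γ ∈ Subgroup.closure S := by
    rw [hS]
    trivial
  induction hγ using Subgroup.closure_induction with
  | mem x hx => exact ⟨1, by simp [hx]⟩
  | one => exact ⟨0, by simp⟩
  | mul x y hx hy ihx ihy =>
    obtain ⟨m, hm⟩ := ihx
    obtain ⟨n, hn⟩ := ihy
    exact ⟨m + n, by rw [pow_add]; exact Set.mul_mem_mul hm hn⟩
  | inv x hx ih =>
    obtain ⟨n, hn⟩ := ih
    refine ⟨n, ?_⟩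
    have hinv : (insert 1 (S ∪ S⁻¹) : Set Γ)⁻¹ = insert 1 (S ∪ S⁻¹) := by
      rw [Set.inv_insert, inv_one, Set.union_inv, inv_inv, Set.union_comm]
    rw [← hinv, inv_pow]
    exact Set.inv_mem_inv.2 hn

theorem exists_finite_subset_ball {S A : Set Γ} (hS : Subgroup.closure S = ⊤) (hA : A.Finite) :
    ∃ c, A ⊆ (insert 1 (S ∪ S⁻¹) : Set Γ) ^ c := by
  induction A, hA using Set.Finite.induction_on with
  | empty => exact ⟨0, Set.empty_subset _⟩
  | @insert x A hx hA ih =>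
    obtain ⟨c, hc⟩ := ih
    obtain ⟨n, hn⟩ := exists_mem_ball hS x
    exact ⟨max n c, Set.insert_subset (ball_subset_ball (le_max_left _ _) hn)
      (hc.trans (ball_subset_ball (le_max_right _ _)))⟩

end Growth

/-! ### Counting codes: the upper bound for the growth -/

theorem ncard_lists_le {A : Type*} [Finite A] (L : ℕ) {B : Type*} (s : Set B)
    (f : B → List A) (hf : Set.InjOn f s) (hL : ∀ x ∈ s, (f x).length ≤ L) :
    s.ncard ≤ (Nat.card A + 1) ^ L := by
  classical
  have := Fintype.ofFinite A
  -- Positions beyond the end of a list are read as `none`; hence the alphabet is enlarged by one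
  -- symbol.
  let g : B → Fin L → Option A := fun x i => (f x)[i.1]?
  have hg : Set.InjOn g s := by
    intro x hx y hy hxy
    refine hf hx hy (List.ext_getElem? fun i => ?_)
    by_cases hi : i < L
    · exact congrFun hxy ⟨i, hi⟩
    · rw [List.getElem?_eq_none, List.getElem?_eq_none]
      · exact (hL y hy).trans (not_lt.1 hi)
      · exact (hL x hx).trans (not_lt.1 hi)
  rw [← hg.ncard_image]
  refine (Set.ncard_le_card _).trans ?_
  simp

section Upper

variable {F : Type*} [Group F]

open scoped Pointwise in
theorem exists_word_length_bound (ω : ℕ → Fin 3) {A : Set (grigorchukWreath F ω)}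
    (hA : A.Finite) :
    ∃ c, ∀ r, ∀ γ ∈ A ^ r, ∃ w : List (Letter F), w.length ≤ c * r ∧ wordElt ω w = γ := by
  choose v hv using wordElt_surjective (F := F) ω
  obtain ⟨c, hc⟩ := (hA.image fun γ => (v γ).length).bddAbove
  refine ⟨c, fun r => ?_⟩
  induction r with
  | zero =>
    intro γ hγ
    rw [pow_zero, Set.mem_one] at hγ
    exact ⟨[], by simp, by simp [wordElt, hγ]⟩
  | succ r ih =>
    intro γ hγ
    rw [pow_succ] at hγ
    obtain ⟨x, hx, y, hy, rfl⟩ := Set.mem_mul.1 hγ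
    obtain ⟨w, hw, rfl⟩ := ih x hx
    refine ⟨w ++ v y, ?_, by rw [wordElt_append, hv]⟩
    have : (v y).length ≤ c := hc ⟨y, hy, rfl⟩
    rw [List.length_append]
    linarith

theorem wordWeight_le_of_length {W : Klein → ℝ} (hW : ∀ x, W x ≤ 4) (w : List (Letter F)) :
    wordWeight W w ≤ 4 * w.length := by
  induction w with
  | nil => simp
  | cons s l ih =>
    have : letterWeight W s ≤ 4 := by
      rcases s with _ | e
      · norm_num [letterWeight]
      · exact hW e.1
    rw [wordWeight_cons, List.length_cons]
    push_cast
    linarith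

open scoped Pointwise in
theorem exists_log_growthFunction_le [Finite F] {η : ℝ} (hη : η ^ 3 + η ^ 2 + η - 2 = 0) (T : ℕ → Bool)
    {S : Set (grigorchukWreath F (modeSeq T 0))} (hS : S.Finite) :
    ∃ C : ℝ, 0 < C ∧ ∀ k r : ℕ, Real.log (growthFunction S r) ≤
      C * 4 ^ changeCount T k * (η ^ rotCount T k * r + 2 ^ k) := by
  obtain ⟨h1, h2⟩ := eta_bounds hη
  obtain ⟨c, hc⟩ := exists_word_length_bound (modeSeq T 0) ((hS.union hS.inv).insert 1)
  set q : ℝ := Real.log ((Nat.card (CodeLetter F) + 1 : ℕ) : ℝ) with hq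
  have hq0 : 0 ≤ q := Real.log_natCast_nonneg _
  -- One factor 4 is the additional one in `length_wordCode_le`, the other bounds the weight of a
  -- letter; `c` counts letters per generator and `q` is the logarithm of the number of symbols.
  refine ⟨16 * (c + 1) * (q + 1), by positivity, fun k r => ?_⟩
  have hw : ∀ γ : grigorchukWreath F (modeSeq T 0), ∃ w : List (Letter F),
      wordElt (modeSeq T 0) w = γ ∧
        (γ ∈ ((insert 1 (S ∪ S⁻¹)) ^ r : Set (grigorchukWreath F (modeSeq T 0))) →
          w.length ≤ c * r) := by
    intro γ
    by_cases hγ : γ ∈ ((insert 1 (S ∪ S⁻¹)) ^ r : Set (grigorchukWreath F (modeSeq T 0)))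
    · obtain ⟨w, hw, e⟩ := hc r γ hγ
      exact ⟨w, e, fun _ => hw⟩
    · obtain ⟨w, e⟩ := wordElt_surjective (modeSeq T 0) γ
      exact ⟨w, e, fun h => (hγ h).elim⟩
  choose w hwe hwl using hw
  set X : ℝ := 4 ^ (changeCount T k + 1) *
      (η ^ rotCount T k * (4 * (c * r)) + (3 * 2 ^ k - 2)) with hX
  have hη0 : 0 < η ^ rotCount T k := pow_pos (by linarith) _
  have h2k : (1 : ℝ) ≤ 2 ^ k := one_le_pow₀ (by norm_num)
  have hX0 : 0 ≤ X := by
    refine mul_nonneg (by positivity) (add_nonneg (by positivity) (by linarith))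
  have hcard : growthFunction S r ≤ (Nat.card (CodeLetter F) + 1) ^ ⌊X⌋₊ := by
    refine ncard_lists_le _ _ (fun γ => wordCode k (modeSeq T 0) (mergeWord (w γ))) ?_ ?_
    · intro γ _ δ _ h
      have := (wordMap_eq_of_wordCode_append_eq k (modeSeq T 0) _ _ [] []
        (congrArg (· ++ []) h)).1
      apply wreathMap_injective
      funext p
      rw [← hwe γ, ← hwe δ, wreathMap_wordElt, wreathMap_wordElt, ← wordMap_mergeWord,
        ← wordMap_mergeWord _ (w δ), this]
    · intro γ hγ
      refine Nat.le_floor ((length_wordCode_le hη k T 0 _ (merged_mergeWord _)).trans ?_)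
      refine mul_le_mul_of_nonneg_left ?_ (by positivity)
      have e1 := wordWeight_mergeWord_le (modeWeight_kleinMul_le hη (T 0) 0) (w γ)
      have e2 := wordWeight_le_of_length (fun x => (modeWeight_bounds hη (T 0) 0 x).2) (w γ)
      have e3 : ((w γ).length : ℝ) ≤ c * r := by exact_mod_cast hwl γ hγ
      have := mul_le_mul_of_nonneg_left (e1.trans (e2.trans (mul_le_mul_of_nonneg_left e3
        (by norm_num : (0 : ℝ) ≤ 4)))) hη0.le
      linarith
  have hpos : 0 < growthFunction S r :=
    (Set.ncard_pos (finite_ball hS r)).2 ⟨1, Set.one_mem_pow (Set.mem_insert 1 _)⟩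
  calc Real.log (growthFunction S r)
      ≤ Real.log (((Nat.card (CodeLetter F) + 1) ^ ⌊X⌋₊ : ℕ) : ℝ) :=
        Real.log_le_log (by exact_mod_cast hpos) (by exact_mod_cast hcard)
    _ = ⌊X⌋₊ * q := by rw [Nat.cast_pow, Real.log_pow]
    _ ≤ X * q := mul_le_mul_of_nonneg_right (Nat.floor_le hX0) hq0
    _ ≤ X * (q + 1) := by nlinarith
    _ ≤ (4 ^ (changeCount T k + 1) * (4 * (c + 1) * (η ^ rotCount T k * r + 2 ^ k))) * (q + 1) := by
        refine mul_le_mul_of_nonneg_right (mul_le_mul_of_nonneg_left ?_ (by positivity))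
          (by linarith)
        have : 0 ≤ η ^ rotCount T k * r := by positivity
        have hc0 : (0 : ℝ) ≤ c := by positivity
        nlinarith
    _ = _ := by ring

end Upper

/-! ### Words with large inverted orbits -/

/-- The action of `a x` for a nontrivial Klein element `x`. -/
def pairMap (ω : ℕ → Fin 3) (x : Fin 3) (y : TreeBoundary) : TreeBoundary :=
  flipFun (kleinAct ω (some x) y)

/-- The inverted orbit of the rightmost ray under the word `a x₁ a x₂ ⋯ a xₙ`. -/
def orbitSet (ω : ℕ → Fin 3) : List (Fin 3) → Set TreeBoundary
  | [] => {rightmostRay}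
  | x :: l => insert rightmostRay (pairMap ω x '' orbitSet ω l)

/-- The points `x₁ a x₂ ⋯ a xᵢ 1^∞` with `1 ≤ i ≤ n`. -/
def halfSet (ω : ℕ → Fin 3) : List (Fin 3) → Set TreeBoundary
  | [] => ∅
  | x :: l => kleinAct ω (some x) '' orbitSet ω l

theorem orbitSet_eq_insert (ω : ℕ → Fin 3) (l : List (Fin 3)) :
    orbitSet ω l = insert rightmostRay (flipFun '' halfSet ω l) := by
  cases l with
  | nil => simp [orbitSet, halfSet]
  | cons x l =>
    rw [orbitSet, halfSet, Set.image_image]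
    rfl

theorem rightmostRay_mem_orbitSet (ω : ℕ → Fin 3) (l : List (Fin 3)) :
    rightmostRay ∈ orbitSet ω l := by
  rw [orbitSet_eq_insert]
  exact Set.mem_insert _ _

theorem finite_orbitSet (ω : ℕ → Fin 3) (l : List (Fin 3)) : (orbitSet ω l).Finite := by
  induction l with
  | nil => exact Set.finite_singleton _
  | cons x l ih => exact (ih.image _).insert _

theorem finite_halfSet (ω : ℕ → Fin 3) (l : List (Fin 3)) : (halfSet ω l).Finite := by
  cases l with
  | nil => exact Set.finite_empty
  | cons x l => exact (finite_orbitSet ω l).image _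

/-- The substitution that doubles the inverted orbits. -/
def pairSubst (i : Fin 3) : List (Fin 3) → List (Fin 3)
  | [] => []
  | x :: l => if x = i then (i + 2) :: i :: (i + 1) :: pairSubst i l else x :: x :: pairSubst i l

theorem pairMap_cons_true (ω : ℕ → Fin 3) (x : Fin 3) (y : TreeBoundary) :
    pairMap ω x (TreeBoundary.cons true y) =
      TreeBoundary.cons false (kleinAct (seqShift ω) (some x) y) := by
  rw [pairMap, kleinAct, kleinFun_cons_true, flipFun_cons]
  rfl

theorem pairMap_cons_false_of_ne {ω : ℕ → Fin 3} {x : Fin 3} (h : ω 0 ≠ x) (y : TreeBoundary) :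
    pairMap ω x (TreeBoundary.cons false y) = TreeBoundary.cons true (flipFun y) := by
  rw [pairMap, kleinAct, kleinFun_cons_false, flipFun_cons]
  simp [kleinBits, h]

theorem pairMap_cons_false_self (ω : ℕ → Fin 3) (y : TreeBoundary) :
    pairMap ω (ω 0) (TreeBoundary.cons false y) = TreeBoundary.cons true y := by
  rw [pairMap, kleinAct, kleinFun_cons_false, flipFun_cons]
  simp [kleinBits]

theorem pairMap_mem_orbitSet {ω : ℕ → Fin 3} (x : Fin 3) {y : TreeBoundary} {l : List (Fin 3)}
    (h : y ∈ orbitSet ω l) : pairMap ω x y ∈ orbitSet ω (x :: l) :=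
  Set.mem_insert_of_mem _ ⟨y, h, rfl⟩

/-- Let i be the current letter of `ω`. For x ≠ i the word a x a x has section a x over 1 and x a
over 0. The word a (i+2) a i a (i+1) exchanges the subtrees, with section i over 1 and a i a over 0.
So the new inverted orbit contains a copy of the old one below 1 and a copy of the half set below 0;
the two claims need each other in the induction. -/
theorem subset_orbitSet_pairSubst (ω : ℕ → Fin 3) (l : List (Fin 3)) :
    (∀ z ∈ orbitSet (seqShift ω) l, TreeBoundary.cons true z ∈ orbitSet ω (pairSubst (ω 0) l)) ∧
      ∀ z ∈ halfSet (seqShift ω) l,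
        TreeBoundary.cons false z ∈ orbitSet ω (pairSubst (ω 0) l) := by
  induction l with
  | nil =>
    constructor
    · intro z hz
      rw [show z = rightmostRay from hz, cons_rightmostRay]
      exact rightmostRay_mem_orbitSet _ _
    · intro z hz
      exact hz.elim
  | cons x l ih =>
    obtain ⟨ih1, ih0⟩ := ih
    have hρ : TreeBoundary.cons true rightmostRay = rightmostRay := cons_rightmostRay
    have hfix : ∀ y : Klein, kleinAct (seqShift ω) y rightmostRay = rightmostRay := fun y =>
      kleinFun_rightmostRay _ _
    have hff : ∀ z, z ∈ orbitSet (seqShift ω) l → z = rightmostRay ∨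
        ∃ h ∈ halfSet (seqShift ω) l, z = flipFun h := by
      intro z hz
      rw [orbitSet_eq_insert] at hz
      rcases hz with rfl | ⟨h, hh, rfl⟩
      · exact Or.inl rfl
      · exact Or.inr ⟨h, hh, rfl⟩
    by_cases hx : x = ω 0
    · subst hx
      have h1 : ω 0 ≠ ω 0 + 1 := by generalize ω 0 = i; revert i; decide
      have h2 : ω 0 ≠ ω 0 + 2 := by generalize ω 0 = i; revert i; decide
      have h21 : kleinMul (some (ω 0 + 2)) (some (ω 0 + 1)) = some (ω 0) := by
        generalize ω 0 = i
        revert i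
        decide
      rw [pairSubst, if_pos rfl]
      constructor
      · rintro z (rfl | ⟨z, hz, rfl⟩)
        · rw [hρ]
          exact rightmostRay_mem_orbitSet _ _
        · rcases hff z hz with rfl | ⟨h, hh, rfl⟩
          -- The base point need not come from the half set; its image is reached by starting in the
          -- middle of the triple.
          · have := pairMap_mem_orbitSet (ω 0 + 2) (pairMap_mem_orbitSet (ω 0)
              (rightmostRay_mem_orbitSet ω ((ω 0 + 1) :: pairSubst (ω 0) l)))
            rwa [← hρ, pairMap_cons_true, hfix, pairMap_cons_false_of_ne h2,
              ← hfix (some (ω 0))] at this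
          · have := pairMap_mem_orbitSet (ω 0 + 2) (pairMap_mem_orbitSet (ω 0)
              (pairMap_mem_orbitSet (ω 0 + 1) (ih0 h hh)))
            rwa [pairMap_cons_false_of_ne h1, pairMap_cons_true,
              pairMap_cons_false_of_ne h2] at this
      · rintro z ⟨z, hz, rfl⟩
        have := pairMap_mem_orbitSet (ω 0 + 2) (pairMap_mem_orbitSet (ω 0)
          (pairMap_mem_orbitSet (ω 0 + 1) (ih1 z hz)))
        rwa [pairMap_cons_true, pairMap_cons_false_self, pairMap_cons_true, ← kleinAct_kleinMul,
          h21] at this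
    · have hx' : ω 0 ≠ x := fun h => hx h.symm
      rw [pairSubst, if_neg hx]
      constructor
      · rintro z (rfl | ⟨z, hz, rfl⟩)
        · rw [hρ]
          exact rightmostRay_mem_orbitSet _ _
        · have := pairMap_mem_orbitSet x (pairMap_mem_orbitSet x (ih1 z hz))
          rwa [pairMap_cons_true, pairMap_cons_false_of_ne hx'] at this
      · rintro z ⟨z, hz, rfl⟩
        rcases hff z hz with rfl | ⟨h, hh, rfl⟩
        · have := pairMap_mem_orbitSet x
            (rightmostRay_mem_orbitSet ω (x :: pairSubst (ω 0) l))
          rwa [← hρ, pairMap_cons_true] at this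
        · have := pairMap_mem_orbitSet x (pairMap_mem_orbitSet x (ih0 h hh))
          rwa [pairMap_cons_false_of_ne hx', pairMap_cons_true] at this

/-- The half set has at most one point less than the orbit, so n points become at least 2n - 1.
Starting from two points this gives 2^k + 1 after k steps. -/
theorem ncard_orbitSet_pairSubst (ω : ℕ → Fin 3) (l : List (Fin 3)) :
    2 * (orbitSet (seqShift ω) l).ncard ≤ (orbitSet ω (pairSubst (ω 0) l)).ncard + 1 := by
  obtain ⟨h1, h0⟩ := subset_orbitSet_pairSubst ω l
  have hsub : TreeBoundary.cons true '' orbitSet (seqShift ω) l ∪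
      TreeBoundary.cons false '' halfSet (seqShift ω) l ⊆ orbitSet ω (pairSubst (ω 0) l) := by
    rintro _ (⟨z, hz, rfl⟩ | ⟨z, hz, rfl⟩)
    · exact h1 z hz
    · exact h0 z hz
  have hdisj : Disjoint (TreeBoundary.cons true '' orbitSet (seqShift ω) l)
      (TreeBoundary.cons false '' halfSet (seqShift ω) l) := by
    rw [Set.disjoint_left]
    rintro _ ⟨z, -, rfl⟩ ⟨z', -, h⟩
    exact cons_false_ne_cons_true _ _ h
  have hcard := Set.ncard_le_ncard hsub (finite_orbitSet _ _)
  rw [Set.ncard_union_eq hdisj ((finite_orbitSet _ _).image _) ((finite_halfSet _ _).image _),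
    Set.ncard_image_of_injective _ (cons_injective true),
    Set.ncard_image_of_injective _ (cons_injective false)] at hcard
  have h2 : (orbitSet (seqShift ω) l).ncard ≤ (halfSet (seqShift ω) l).ncard + 1 := by
    rw [orbitSet_eq_insert]
    refine (Set.ncard_insert_le _ _).trans ?_
    exact Nat.add_le_add_right (Set.ncard_image_le (finite_halfSet _ _)) 1
  omega

/-- The iterated substitution. -/
def orbitWord : ℕ → (ℕ → Fin 3) → List (Fin 3)
  | 0, _ => [0]
  | k + 1, ω => pairSubst (ω 0) (orbitWord k (seqShift ω))

theorem two_pow_lt_ncard_orbitSet (k : ℕ) (ω : ℕ → Fin 3) :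
    2 ^ k + 1 ≤ (orbitSet ω (orbitWord k ω)).ncard := by
  induction k generalizing ω with
  | zero =>
    have hne : rightmostRay ≠ flipFun rightmostRay := by
      intro h
      have := congrFun h 0
      simp [rightmostRay, flipFun] at this
    have : orbitSet ω (orbitWord 0 ω) = {rightmostRay, flipFun rightmostRay} := by
      simp only [orbitWord, orbitSet, Set.image_singleton, pairMap, kleinAct,
        kleinFun_rightmostRay]
    rw [this, Set.ncard_pair hne]
    norm_num
  | succ k ih =>
    have h1 := ih (seqShift ω)
    have h2 := ncard_orbitSet_pairSubst ω (orbitWord k (seqShift ω))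
    rw [orbitWord, pow_succ]
    omega

/-! ### The length of the iterated substitution -/

/-- The weights of pairs that belong to a mode. -/
noncomputable def pairWeight (η : ℝ) (m : Bool) (j x : Fin 3) : ℝ :=
  if m then ![η ^ 2, η, 1] (x - j) else ![2, 1, 1] x

theorem pairWeight_bounds {η : ℝ} (hη : η ^ 3 + η ^ 2 + η - 2 = 0) (m : Bool) (j x : Fin 3) :
    1 ≤ 2 * pairWeight η m j x ∧ pairWeight η m j x ≤ 2 := by
  obtain ⟨h1, h2⟩ := eta_bounds hη
  rw [pairWeight]
  generalize x - j = r
  cases m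
  · fin_cases x <;> norm_num
  · fin_cases r <;> simp only [if_true, Fin.zero_eta, Fin.mk_one, Fin.reduceFinMk,
      Matrix.cons_val] <;> constructor <;> nlinarith

theorem pairWeight_le {η : ℝ} (hη : η ^ 3 + η ^ 2 + η - 2 = 0) (m m' : Bool) (j x : Fin 3) :
    pairWeight η m j x ≤ 4 ^ (if m = m' then 0 else 1) * pairWeight η m' j x := by
  by_cases h : m = m'
  · simp [h]
  · have h1 := pairWeight_bounds hη m j x
    have h2 := pairWeight_bounds hη m' j x
    rw [if_neg h, pow_one]
    linarith

theorem sum_map_pairSubst (V V' : Fin 3 → ℝ) (lam : ℝ) (i : Fin 3)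
    (h : ∀ x, x ≠ i → 2 * V x = lam * V' x) (hi : V (i + 2) + V i + V (i + 1) = lam * V' i)
    (l : List (Fin 3)) : ((pairSubst i l).map V).sum = lam * (l.map V').sum := by
  induction l with
  | nil => simp [pairSubst]
  | cons x l ih =>
    rw [pairSubst]
    split_ifs with hx
    · subst hx
      simp only [List.map_cons, List.sum_cons, ih]
      linarith
    · simp only [List.map_cons, List.sum_cons, ih]
      linarith [h x hx]

/-- The weights are eigenvectors of the substitution. In the rotating mode the replacement of the
current letter by a triple requires 1 + η + η² = 2/η, which is the equation for η; in the constant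
mode it is 1 + 2 + 1 = 2 * 2. -/
theorem sum_pairWeight_pairSubst {η : ℝ} (hη : η ^ 3 + η ^ 2 + η - 2 = 0) (T : ℕ → Bool)
    (j : Fin 3) (l : List (Fin 3)) :
    ((pairSubst (modeSeq T j 0) l).map (pairWeight η (T 0) j)).sum =
      2 / modeFactor η (T 0) * (l.map (pairWeight η (T 0) (j + 1))).sum := by
  obtain ⟨h1, h2⟩ := eta_bounds hη
  have hη0 : η ≠ 0 := by positivity
  apply sum_map_pairSubst
  · intro x hx
    cases h : T 0
    · rw [modeSeq_zero_of_false h] at hx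
      simp [pairWeight, modeFactor]
    · rw [modeSeq_zero_of_true h] at hx
      have key : (x - j = 1 ∧ x - (j + 1) = 0) ∨ (x - j = 2 ∧ x - (j + 1) = 1) := by
        revert x j
        decide
      simp only [pairWeight, modeFactor, if_true]
      rcases key with ⟨e1, e2⟩ | ⟨e1, e2⟩ <;> rw [e1, e2] <;> simp only [Matrix.cons_val] <;>
        field_simp
  · cases h : T 0
    · rw [modeSeq_zero_of_false h]
      simp [pairWeight, modeFactor]
      norm_num
    · rw [modeSeq_zero_of_true h]
      have e0 : j + 2 - j = 2 := by revert j; decide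
      have e1 : j + 1 - j = 1 := by revert j; decide
      have e2 : j - (j + 1) = 2 := by revert j; decide
      simp only [pairWeight, modeFactor, if_true, e0, e1, e2, sub_self, Matrix.cons_val]
      field_simp
      linarith

theorem sum_pairWeight_orbitWord_le {η : ℝ} (hη : η ^ 3 + η ^ 2 + η - 2 = 0) (k : ℕ)
    (T : ℕ → Bool) (j : Fin 3) :
    ((orbitWord k (modeSeq T j)).map (pairWeight η (T 0) j)).sum ≤
      2 * (4 ^ changeCount T k * (2 ^ k / η ^ rotCount T k)) := by
  obtain ⟨h1, h2⟩ := eta_bounds hη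
  have hη0 : 0 < η := by linarith
  induction k generalizing T j with
  | zero => simpa [orbitWord, changeCount, rotCount] using (pairWeight_bounds hη (T 0) j 0).2
  | succ k ih =>
    have h := ih (seqShift T) (j + 1)
    rw [orbitWord, sum_pairWeight_pairSubst hη, seqShift_modeSeq]
    have hf : 0 < modeFactor η (T 0) := by
      unfold modeFactor
      split_ifs <;> linarith
    have hconv : ∀ l : List (Fin 3), (l.map (pairWeight η (T 0) (j + 1))).sum ≤
        4 ^ (if T 0 = T 1 then 0 else 1) * (l.map (pairWeight η (T 1) (j + 1))).sum := by
      intro l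
      rw [← List.sum_map_mul_left]
      exact List.sum_le_sum fun x _ => pairWeight_le hη _ _ _ _
    have hrot : η ^ rotCount T (k + 1) = modeFactor η (T 0) * η ^ rotCount (seqShift T) k := by
      rw [rotCount, modeFactor, pow_add]
      split_ifs <;> simp
    have hN : 0 < η ^ rotCount (seqShift T) k := by positivity
    calc _ ≤ 2 / modeFactor η (T 0) * (4 ^ (if T 0 = T 1 then 0 else 1) *
          (2 * (4 ^ changeCount (seqShift T) k * (2 ^ k / η ^ rotCount (seqShift T) k)))) := by
          refine mul_le_mul_of_nonneg_left ((hconv _).trans ?_) (by positivity)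
          exact mul_le_mul_of_nonneg_left h (by positivity)
      _ = _ := by
          rw [hrot, changeCount, pow_add, pow_succ]
          field_simp

theorem length_orbitWord_le {η : ℝ} (hη : η ^ 3 + η ^ 2 + η - 2 = 0) (k : ℕ)
    (T : ℕ → Bool) (j : Fin 3) :
    ((orbitWord k (modeSeq T j)).length : ℝ) ≤
      4 * (4 ^ changeCount T k * (2 ^ k / η ^ rotCount T k)) := by
  have h := sum_pairWeight_orbitWord_le hη k T j
  have h2 : ∀ l : List (Fin 3), (l.length : ℝ) ≤ 2 * (l.map (pairWeight η (T 0) j)).sum := by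
    intro l
    induction l with
    | nil => simp
    | cons x l ih =>
      have := (pairWeight_bounds hη (T 0) j x).1
      simp only [List.length_cons, List.map_cons, List.sum_cons]
      push_cast
      linarith
  linarith [h2 (orbitWord k (modeSeq T j))]

/-! ### The lower bound -/

section Lower

variable {F : Type*} [Group F]

/-- The action of the word `a x₁ a x₂ ⋯ a xₙ`. -/
def pairListMap (ω : ℕ → Fin 3) (l : List (Fin 3)) (y : TreeBoundary) : TreeBoundary :=
  l.foldr (pairMap ω) y

theorem pairMap_surjective (ω : ℕ → Fin 3) (x : Fin 3) : Function.Surjective (pairMap ω x) :=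
  flipFun_involutive.surjective.comp (kleinFun_involutive _ ω).surjective

theorem pairMap_injective (ω : ℕ → Fin 3) (x : Fin 3) : Function.Injective (pairMap ω x) :=
  flipFun_involutive.injective.comp (kleinFun_involutive _ ω).injective

theorem pairListMap_surjective (ω : ℕ → Fin 3) (l : List (Fin 3)) :
    Function.Surjective (pairListMap ω l) := by
  induction l with
  | nil => exact Function.surjective_id
  | cons x l ih => exact (pairMap_surjective ω x).comp ih

open Classical in
theorem exists_word_of_support_subset (ω : ℕ → Fin 3) (l : List (Fin 3)) (ψ : TreeBoundary → F)
    (hψ : ∀ y, y ∉ orbitSet ω l → ψ y = 1) :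
    ∃ w : List (Letter F), w.length = 3 * l.length + 1 ∧
      ∀ p, wordMap ω w p = (pairListMap ω l p.1, ψ (pairListMap ω l p.1) * p.2) := by
  induction l generalizing ψ with
  | nil =>
    refine ⟨[some (none, ψ rightmostRay)], by simp, fun p => ?_⟩
    have : lampAt (ψ rightmostRay) p.1 = ψ p.1 := by
      by_cases h : p.1 = rightmostRay
      · rw [lampAt, if_pos h, h]
      · rw [lampAt, if_neg h, hψ _ h]
    simp [letterMap, kleinAct_none, pairListMap, this]
  | cons x l ih =>
    let ψ' : TreeBoundary → F := fun y => if y ∈ orbitSet ω l then ψ (pairMap ω x y) else 1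
    obtain ⟨w, hw, hwm⟩ := ih ψ' fun y hy => if_neg hy
    obtain ⟨y₀, hy₀⟩ := pairMap_surjective ω x rightmostRay
    -- The inverted orbit may return to 1^∞, in which case the remaining word has already placed a
    -- lamp there; the inverse corrects for it.
    let f : F := ψ rightmostRay * (ψ' y₀)⁻¹
    refine ⟨some (none, f) :: none :: some (some x, 1) :: w, by simp [hw]; ring, fun p => ?_⟩
    have key : ∀ y, lampAt f (pairMap ω x y) * ψ' y = ψ (pairMap ω x y) := by
      intro y
      by_cases h : pairMap ω x y = rightmostRay
      · have : y = y₀ := pairMap_injective ω x (h.trans hy₀.symm)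
        rw [lampAt, if_pos h, h, this, inv_mul_cancel_right]
      · rw [lampAt, if_neg h, one_mul]
        by_cases hy : y ∈ orbitSet ω l
        · exact if_pos hy
        · refine (if_neg hy).trans (hψ _ ?_).symm
          rintro (h' | ⟨z, hz, h'⟩)
          · exact h h'
          · exact hy (pairMap_injective ω x h' ▸ hz)
    have hlist : pairListMap ω (x :: l) p.1 = pairMap ω x (pairListMap ω l p.1) := rfl
    rw [hlist, ← key]
    simp only [wordMap_cons, hwm, letterMap, lampAt_one, one_mul, kleinAct_none, mul_assoc]
    rfl

open scoped Pointwise in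
theorem wordElt_mem_ball {ω : ℕ → Fin 3} {A : Set (grigorchukWreath F ω)}
    (hA : ∀ s, letterElt ω s ∈ A) (w : List (Letter F)) : wordElt ω w ∈ A ^ w.length := by
  induction w with
  | nil => simp [wordElt]
  | cons s l ih =>
    have : wordElt ω (s :: l) = letterElt ω s * wordElt ω l := by simp [wordElt]
    rw [this, List.length_cons, pow_succ']
    exact Set.mul_mem_mul (hA s) ih

open scoped Pointwise in
open Classical in
theorem exists_le_log_growthFunction [Finite F] [Nontrivial F] {η : ℝ}
    (hη : η ^ 3 + η ^ 2 + η - 2 = 0) (T : ℕ → Bool)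
    {S : Set (grigorchukWreath F (modeSeq T 0))} (hS : S.Finite)
    (hgen : Subgroup.closure S = ⊤) :
    ∃ C : ℝ, 0 < C ∧ ∀ k r : ℕ, C * 4 ^ changeCount T k * (2 ^ k / η ^ rotCount T k) ≤ r →
      2 ^ k * Real.log 2 ≤ Real.log (growthFunction S r) := by
  obtain ⟨h1, h2⟩ := eta_bounds hη
  obtain ⟨c, hc⟩ := exists_finite_subset_ball hgen (Set.finite_range (letterElt (F := F) (modeSeq T 0)))
  -- The words have 3n + 1 letters with n at most 4 times the scale, and 3 * 4 + 1 = 13; each letter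
  -- costs at most `c` generators.
  refine ⟨13 * c + 1, by positivity, fun k r hr => ?_⟩
  set l := orbitWord k (modeSeq T 0) with hl
  -- One nontrivial lamp value suffices: the subsets of the inverted orbit give different elements.
  obtain ⟨f, hf⟩ := exists_ne (1 : F)
  have hex : ∀ s : Set TreeBoundary, ∃ w : List (Letter F), s ⊆ orbitSet (modeSeq T 0) l →
      w.length = 3 * l.length + 1 ∧ ∀ p, wordMap (modeSeq T 0) w p =
        (pairListMap (modeSeq T 0) l p.1, (if pairListMap (modeSeq T 0) l p.1 ∈ s then f else 1) * p.2) := by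
    intro s
    by_cases hs : s ⊆ orbitSet (modeSeq T 0) l
    · obtain ⟨w, hw⟩ := exists_word_of_support_subset (modeSeq T 0) l (fun y => if y ∈ s then f else 1)
        (fun y hy => if_neg fun h => hy (hs h))
      exact ⟨w, fun _ => hw⟩
    · exact ⟨[], fun h => (hs h).elim⟩
  choose w hw using hex
  have hlen : c * (3 * l.length + 1) ≤ r := by
    have e1 := length_orbitWord_le hη k T 0
    have hη0 : 0 < η ^ rotCount T k := pow_pos (by linarith) _
    have e2 : (1 : ℝ) ≤ 4 ^ changeCount T k * (2 ^ k / η ^ rotCount T k) := by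
      have a1 : (1 : ℝ) ≤ 4 ^ changeCount T k := one_le_pow₀ (by norm_num)
      have a2 : (1 : ℝ) ≤ 2 ^ k := one_le_pow₀ (by norm_num)
      have a3 : η ^ rotCount T k ≤ 1 := pow_le_one₀ (by linarith) (by linarith)
      have : 1 ≤ 2 ^ k / η ^ rotCount T k := (one_le_div hη0).2 (a3.trans a2)
      exact one_le_mul_of_one_le_of_one_le a1 this
    have e3 : (c : ℝ) * (3 * l.length + 1) ≤ r := by
      refine le_trans ?_ hr
      have : (3 * (l.length : ℝ) + 1) ≤ 13 * (4 ^ changeCount T k * (2 ^ k / η ^ rotCount T k)) := by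
        linarith
      have := mul_le_mul_of_nonneg_left this (Nat.cast_nonneg (α := ℝ) c)
      linarith
    exact_mod_cast e3
  have hinj : Set.InjOn (fun s => wordElt (modeSeq T 0) (w s)) (𝒫 orbitSet (modeSeq T 0) l) := by
    intro s hs t ht h
    have hst : ∀ p, wordMap (modeSeq T 0) (w s) p = wordMap (modeSeq T 0) (w t) p := by
      intro p
      rw [← wreathMap_wordElt, ← wreathMap_wordElt]
      exact congrArg (fun γ => wreathMap γ p) h
    ext y
    obtain ⟨z, rfl⟩ := pairListMap_surjective (modeSeq T 0) l y
    have := congrArg Prod.snd (hst (z, 1))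
    rw [(hw s hs).2, (hw t ht).2] at this
    by_cases h1 : pairListMap (modeSeq T 0) l z ∈ s <;> by_cases h2 : pairListMap (modeSeq T 0) l z ∈ t <;>
      simp [h1, h2, hf, hf.symm] at this ⊢
  have hsub : (fun s => wordElt (modeSeq T 0) (w s)) '' (𝒫 orbitSet (modeSeq T 0) l) ⊆
      ((insert 1 (S ∪ S⁻¹)) ^ r : Set (grigorchukWreath F (modeSeq T 0))) := by
    rintro _ ⟨s, hs, rfl⟩
    have := wordElt_mem_ball (fun s => hc ⟨s, rfl⟩) (w s)
    rw [(hw s hs).1, ← pow_mul] at this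
    exact ball_subset_ball hlen this
  have hcard := Set.ncard_le_ncard hsub (finite_ball hS r)
  rw [hinj.ncard_image, Set.ncard_powerset _ (finite_orbitSet (modeSeq T 0) l)] at hcard
  have hpow : 2 ^ (2 ^ k) ≤ growthFunction S r :=
    (Nat.pow_le_pow_right (by norm_num)
      ((Nat.le_succ _).trans (two_pow_lt_ncard_orbitSet k (modeSeq T 0)))).trans hcard
  have hfin : ((2 : ℝ) ^ (2 ^ k : ℕ)) ≤ growthFunction S r := by exact_mod_cast hpow
  have := Real.log_le_log (by positivity) hfin
  rw [Real.log_pow] at this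
  exact_mod_cast this

end Lower

/-! ### Sequences of modes with prescribed densities -/

theorem rotCount_succ (T : ℕ → Bool) (k : ℕ) :
    rotCount T (k + 1) = rotCount T k + if T k then 1 else 0 := by
  induction k generalizing T with
  | zero => simp [rotCount]
  | succ k ih =>
    rw [rotCount, ih, rotCount]
    exact (add_assoc _ _ _).symm

theorem changeCount_succ (T : ℕ → Bool) (k : ℕ) :
    changeCount T (k + 1) = changeCount T k + if T k = T (k + 1) then 0 else 1 := by
  induction k generalizing T with
  | zero => simp [changeCount]
  | succ k ih =>
    rw [changeCount, ih, changeCount]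
    exact (add_assoc _ _ _).symm

theorem rotCount_mono (T : ℕ → Bool) : Monotone (rotCount T) :=
  monotone_nat_of_le_succ fun k => by rw [rotCount_succ]; exact Nat.le_add_right _ _

theorem changeCount_mono (T : ℕ → Bool) : Monotone (changeCount T) :=
  monotone_nat_of_le_succ fun k => by rw [changeCount_succ]; exact Nat.le_add_right _ _

theorem rotCount_add_le (T : ℕ → Bool) (k i : ℕ) : rotCount T (k + i) ≤ rotCount T k + i := by
  induction i with
  | zero => exact le_rfl
  | succ i ih =>
    rw [← add_assoc, rotCount_succ]
    split_ifs <;> omega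

open Classical in
/-- The sequence of modes that rotates at the beginning of each block `[m², (m + 1)²)`, for the
proportion `τ m` of the block. -/
noncomputable def blockMode (τ : ℕ → ℝ) (k : ℕ) : Bool :=
  decide (((k - k.sqrt ^ 2 : ℕ) : ℝ) < τ k.sqrt * (2 * k.sqrt + 1))

theorem blockMode_sq_add (τ : ℕ → ℝ) {m i : ℕ} (hi : i ≤ 2 * m) :
    blockMode τ (m ^ 2 + i) = true ↔ (i : ℝ) < τ m * (2 * m + 1) := by
  have hs : (m ^ 2 + i).sqrt = m := by
    rw [pow_two]
    exact Nat.sqrt_add_eq m (by omega)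
  rw [blockMode, hs, Nat.add_sub_cancel_left, decide_eq_true_iff]

/-- Inside a block the mode can only change from rotating to constant, hence at most once; the last
summand records whether this may have happened. Each passage to the next block allows one more
change. -/
theorem changeCount_blockMode_sq_add_le (τ : ℕ → ℝ) (m : ℕ)
    (h : changeCount (blockMode τ) (m ^ 2) ≤ 2 * m) (i : ℕ) (hi : i ≤ 2 * m) :
    changeCount (blockMode τ) (m ^ 2 + i) ≤
      2 * m + if blockMode τ (m ^ 2 + i) then 0 else 1 := by
  induction i with
  | zero => exact le_add_right h
  | succ i ih =>
    have h1 := ih (by omega)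
    rw [← add_assoc, changeCount_succ]
    have hmono : blockMode τ (m ^ 2 + i + 1) = true → blockMode τ (m ^ 2 + i) = true := by
      intro h
      rw [add_assoc, blockMode_sq_add τ hi] at h
      rw [blockMode_sq_add τ (by omega)]
      push_cast at h
      linarith
    revert h1 hmono
    cases blockMode τ (m ^ 2 + i) <;> cases blockMode τ (m ^ 2 + i + 1) <;> simp

theorem changeCount_blockMode_sq_le (τ : ℕ → ℝ) (m : ℕ) :
    changeCount (blockMode τ) (m ^ 2) ≤ 2 * m := by
  induction m with
  | zero => simp [changeCount]
  | succ m ih =>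
    have h := changeCount_blockMode_sq_add_le τ m ih (2 * m) le_rfl
    have e : (m + 1) ^ 2 = m ^ 2 + 2 * m + 1 := by ring
    rw [e, changeCount_succ]
    split_ifs at h ⊢ <;> omega

theorem exists_sq_add (k : ℕ) : ∃ i ≤ 2 * k.sqrt, k = k.sqrt ^ 2 + i := by
  refine ⟨k - k.sqrt ^ 2, ?_, ?_⟩
  · have := Nat.sqrt_le_add k
    rw [pow_two]
    omega
  · have := Nat.sqrt_le' k
    omega

theorem changeCount_blockMode_le (τ : ℕ → ℝ) (k : ℕ) :
    changeCount (blockMode τ) k ≤ 2 * k.sqrt + 1 := by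
  obtain ⟨i, hi, hk⟩ := exists_sq_add k
  have := changeCount_blockMode_sq_add_le τ k.sqrt (changeCount_blockMode_sq_le τ _) i hi
  rw [← hk] at this
  refine this.trans ?_
  split_ifs <;> omega

theorem rotCount_blockMode_sq_add (τ : ℕ → ℝ) (m i : ℕ) (hi : i ≤ 2 * m + 1)
    (h0 : 0 ≤ τ m) :
    min (i : ℝ) (τ m * (2 * m + 1)) ≤
        rotCount (blockMode τ) (m ^ 2 + i) - rotCount (blockMode τ) (m ^ 2) ∧
      (rotCount (blockMode τ) (m ^ 2 + i) - rotCount (blockMode τ) (m ^ 2) : ℝ) ≤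
        min (i : ℝ) (τ m * (2 * m + 1) + 1) := by
  have hx : 0 ≤ τ m * (2 * m + 1) := by positivity
  induction i with
  | zero => simp [hx]; linarith
  | succ i ih =>
    obtain ⟨h1, h2⟩ := ih (by omega)
    have hb := blockMode_sq_add τ (m := m) (i := i) (by omega)
    rw [← add_assoc, rotCount_succ]
    have h2' := le_min_iff.1 h2
    by_cases hc : (i : ℝ) < τ m * (2 * m + 1)
    · rw [if_pos (hb.2 hc)]
      rw [min_eq_left hc.le] at h1
      push_cast
      constructor
      · exact (min_le_left _ _).trans (by linarith)
      · exact le_min (by linarith) (by linarith)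
    · rw [if_neg (mt hb.1 hc)]
      rw [min_eq_right (not_lt.1 hc)] at h1
      push_cast
      constructor
      · exact (min_le_right _ _).trans (by linarith)
      · exact le_min (by linarith) (by linarith)

/-- The expected number of rotating places in the first `m` blocks. -/
noncomputable def blockSum (τ : ℕ → ℝ) (m : ℕ) : ℝ := ∑ i ∈ Finset.range m, τ i * (2 * i + 1)

theorem blockSum_succ (τ : ℕ → ℝ) (m : ℕ) :
    blockSum τ (m + 1) = blockSum τ m + τ m * (2 * m + 1) :=
  Finset.sum_range_succ _ _

theorem rotCount_blockMode_sq (τ : ℕ → ℝ) (h0 : ∀ m, 0 ≤ τ m) (h1 : ∀ m, τ m ≤ 1) (m : ℕ) :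
    blockSum τ m ≤ rotCount (blockMode τ) (m ^ 2) ∧
      (rotCount (blockMode τ) (m ^ 2) : ℝ) ≤ blockSum τ m + m := by
  induction m with
  | zero => simp [blockSum, rotCount]
  | succ m ih =>
    have e : (m + 1) ^ 2 = m ^ 2 + (2 * m + 1) := by ring
    obtain ⟨a, b⟩ := rotCount_blockMode_sq_add τ m (2 * m + 1) le_rfl (h0 m)
    have hm : τ m * (2 * m + 1) ≤ 2 * m + 1 :=
      mul_le_of_le_one_left (by positivity) (h1 m)
    rw [e, blockSum_succ]
    push_cast at *
    rw [min_eq_right hm] at a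
    have b' := (le_min_iff.1 b).2
    constructor <;> linarith

theorem blockSum_le_of_le {τ : ℕ → ℝ} {p : ℝ} {M N : ℕ} (hMN : M ≤ N)
    (h : ∀ m, M ≤ m → m < N → τ m ≤ p) :
    blockSum τ N - blockSum τ M ≤ p * ((N : ℝ) ^ 2 - (M : ℝ) ^ 2) := by
  induction N, hMN using Nat.le_induction with
  | base => simp
  | succ N hN ih =>
    have h1 := ih fun m hm hm' => h m hm (hm'.trans N.lt_succ_self)
    have h2 := mul_le_mul_of_nonneg_right (h N hN N.lt_succ_self)
      (by positivity : (0 : ℝ) ≤ 2 * N + 1)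
    rw [blockSum_succ]
    push_cast
    linarith

theorem le_blockSum_of_le {τ : ℕ → ℝ} {p : ℝ} {M N : ℕ} (hMN : M ≤ N)
    (h : ∀ m, M ≤ m → m < N → p ≤ τ m) :
    p * ((N : ℝ) ^ 2 - (M : ℝ) ^ 2) ≤ blockSum τ N - blockSum τ M := by
  induction N, hMN using Nat.le_induction with
  | base => simp
  | succ N hN ih =>
    have h1 := ih fun m hm hm' => h m hm (hm'.trans N.lt_succ_self)
    have h2 := mul_le_mul_of_nonneg_right (h N hN N.lt_succ_self)
      (by positivity : (0 : ℝ) ≤ 2 * N + 1)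
    rw [blockSum_succ]
    push_cast
    linarith

theorem log_log_eq {i m : ℕ} (h1 : 2 ^ 2 ^ i ≤ m) (h2 : m < 2 ^ 2 ^ (i + 1)) :
    Nat.log 2 (Nat.log 2 m) = i := by
  have hm : m ≠ 0 := by
    have : 0 < 2 ^ 2 ^ i := by positivity
    omega
  have h3 : 2 ^ i ≤ Nat.log 2 m := Nat.le_log_of_pow_le (by norm_num) h1
  have h4 : Nat.log 2 m < 2 ^ (i + 1) := Nat.log_lt_of_lt_pow hm h2
  exact Nat.log_eq_of_pow_le_of_lt_pow h3 h4

theorem exists_mode_densities {p q : ℝ} (hp : 0 ≤ p) (hpq : p ≤ q) (hq : q ≤ 1) :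
    ∃ T : ℕ → Bool, (∀ k, changeCount T k ≤ 2 * k.sqrt + 1) ∧
      (∀ k : ℕ, p * k - 3 * (k.sqrt + 1) ≤ rotCount T k ∧
        (rotCount T k : ℝ) ≤ q * k + 3 * (k.sqrt + 1)) ∧
      (∀ K : ℕ, ∃ k : ℕ, K ≤ k ∧ (rotCount T k : ℝ) ≤ p * k + 3 * (k.sqrt + 1)) ∧
      (∀ K : ℕ, ∃ k : ℕ, K ≤ k ∧ q * k - 3 * (k.sqrt + 1) ≤ (rotCount T k : ℝ)) := by
  -- The proportion is constant for m in [2^(2^i), 2^(2^(i+1))), and these ranges use `p` and `q`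
  -- alternately.
  set τ : ℕ → ℝ := fun m => if Even (Nat.log 2 (Nat.log 2 m)) then p else q with hτ
  have hτp : ∀ m, p ≤ τ m := fun m => by simp only [hτ]; split_ifs <;> linarith
  have hτq : ∀ m, τ m ≤ q := fun m => by simp only [hτ]; split_ifs <;> linarith
  have hsq := rotCount_blockMode_sq τ (fun m => hp.trans (hτp m)) (fun m => (hτq m).trans hq)
  have hB0 : blockSum τ 0 = 0 := by simp [blockSum]
  have hBp : ∀ m : ℕ, p * (m : ℝ) ^ 2 ≤ blockSum τ m := fun m => by
    simpa [hB0] using le_blockSum_of_le (p := p) (Nat.zero_le m) (fun i _ _ => hτp i)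
  have hBq : ∀ m : ℕ, blockSum τ m ≤ q * (m : ℝ) ^ 2 := fun m => by
    simpa [hB0] using blockSum_le_of_le (p := q) (Nat.zero_le m) (fun i _ _ => hτq i)
  have hlarge : ∀ i : ℕ, i ≤ 2 ^ 2 ^ (i + 1) ∧ (2 ^ 2 ^ (i + 1) : ℕ) ≤ (2 ^ 2 ^ (i + 1)) ^ 2 ∧
      2 ^ 2 ^ i ≤ 2 ^ 2 ^ (i + 1) := by
    intro i
    refine ⟨?_, Nat.le_self_pow (by norm_num) _, ?_⟩
    · exact (Nat.lt_two_pow_self (n := i)).le.trans ((Nat.lt_two_pow_self (n := 2 ^ i)).le.trans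
        (Nat.pow_le_pow_right (by norm_num) (Nat.pow_le_pow_right (by norm_num) (by omega))))
    · exact Nat.pow_le_pow_right (by norm_num) (Nat.pow_le_pow_right (by norm_num) (by omega))
  -- If a range ends at M, the earlier ranges fill only the first M of the M² places. So they
  -- disturb the count by O(M), the square root of the level.
  have hMM : ∀ i : ℕ, ((2 ^ 2 ^ i : ℕ) : ℝ) ^ 2 = ((2 ^ 2 ^ (i + 1) : ℕ) : ℝ) := by
    intro i
    push_cast
    rw [← pow_mul, pow_succ]
  refine ⟨blockMode τ, changeCount_blockMode_le τ, ?_, ?_, ?_⟩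
  · intro k
    obtain ⟨i, hi, hk⟩ := exists_sq_add k
    set M := k.sqrt
    have h1 := hsq M
    have h2 : (rotCount (blockMode τ) (M ^ 2) : ℝ) ≤ rotCount (blockMode τ) (M ^ 2 + i) := by
      exact_mod_cast rotCount_mono (blockMode τ) (Nat.le_add_right _ _)
    have h3 : (rotCount (blockMode τ) (M ^ 2 + i) : ℝ) ≤ rotCount (blockMode τ) (M ^ 2) + i := by
      exact_mod_cast rotCount_add_le (blockMode τ) _ _
    rw [← hk] at h2 h3
    have hk' : (k : ℝ) = (M : ℝ) ^ 2 + i := by exact_mod_cast hk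
    have hi' : (i : ℝ) ≤ 2 * M := by exact_mod_cast hi
    have h4 := hBp M
    have h5 := hBq M
    have hM : (0 : ℝ) ≤ M := by positivity
    have hi0 : (0 : ℝ) ≤ i := by positivity
    rw [hk']
    constructor
    · nlinarith
    · nlinarith
  · intro K
    have he : Even (2 * K) := even_two_mul K
    obtain ⟨a, b, c⟩ := hlarge (2 * K)
    have hM := hMM (2 * K)
    set M := 2 ^ 2 ^ (2 * K + 1)
    set N := 2 ^ 2 ^ (2 * K)
    refine ⟨M ^ 2, by omega, ?_⟩
    have h1 := blockSum_le_of_le (τ := τ) (p := p) c (fun m h h' => by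
      simp only [hτ, log_log_eq h h', he, if_true, le_refl])
    have h2 := hBq N
    have h3 := (hsq M).2
    rw [Nat.sqrt_eq']
    rw [hM] at h1 h2
    push_cast
    have : (0 : ℝ) ≤ M := by positivity
    nlinarith
  · intro K
    have he : ¬ Even (2 * K + 1) := by simp
    obtain ⟨a, b, c⟩ := hlarge (2 * K + 1)
    have hM := hMM (2 * K + 1)
    set M := 2 ^ 2 ^ (2 * K + 1 + 1)
    set N := 2 ^ 2 ^ (2 * K + 1)
    refine ⟨M ^ 2, by omega, ?_⟩
    have h1 := le_blockSum_of_le (τ := τ) (p := q) c (fun m h h' => by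
      simp only [hτ, log_log_eq h h', he, if_false, le_refl])
    have h2 := hBp N
    have h3 := (hsq M).1
    rw [Nat.sqrt_eq']
    rw [hM] at h1 h2
    push_cast
    have : (0 : ℝ) ≤ M := by positivity
    nlinarith

/-! ### Asymptotics -/

/-- The length scale that belongs to the level `k`. -/
noncomputable def levelScale (η : ℝ) (T : ℕ → Bool) (k : ℕ) : ℝ := 2 ^ k / η ^ rotCount T k

theorem log_levelScale {η : ℝ} (hη : 0 < η) (T : ℕ → Bool) (k : ℕ) :
    Real.log (levelScale η T k) = k * Real.log 2 - rotCount T k * Real.log η := by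
  rw [levelScale, Real.log_div (by positivity) (by positivity), Real.log_pow, Real.log_pow]

theorem levelScale_succ_bounds {η : ℝ} (h1 : 0.8 < η) (h2 : η < 0.82) (T : ℕ → Bool) (k : ℕ) :
    2 * levelScale η T k ≤ levelScale η T (k + 1) ∧
      levelScale η T (k + 1) ≤ 3 * levelScale η T k := by
  have hN : 0 < η ^ rotCount T k := pow_pos (by linarith) _
  have hk : (0 : ℝ) < 2 ^ k := by positivity
  rw [levelScale, levelScale, rotCount_succ]
  split_ifs
  · have : (2 : ℝ) ^ (k + 1) / η ^ (rotCount T k + 1) = (2 / η) * (2 ^ k / η ^ rotCount T k) := by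
      rw [pow_succ, pow_succ]
      field_simp
    rw [this]
    have h3 : 2 ≤ 2 / η := by rw [le_div_iff₀ (by linarith)]; linarith
    have h4 : 2 / η ≤ 3 := by rw [div_le_iff₀ (by linarith)]; linarith
    exact ⟨mul_le_mul_of_nonneg_right h3 (by positivity),
      mul_le_mul_of_nonneg_right h4 (by positivity)⟩
  · have : (2 : ℝ) ^ (k + 1) / η ^ (rotCount T k + 0) = 2 * (2 ^ k / η ^ rotCount T k) := by
      rw [pow_succ, add_zero]
      ring
    rw [this]
    have : 0 < 2 ^ k / η ^ rotCount T k := by positivity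
    constructor <;> linarith

theorem levelScale_pos {η : ℝ} (hη : 0 < η) (T : ℕ → Bool) (k : ℕ) : 0 < levelScale η T k := by
  unfold levelScale
  positivity

theorem two_pow_le_levelScale {η : ℝ} (h1 : 0.8 < η) (h2 : η < 0.82) (T : ℕ → Bool) (k : ℕ) :
    2 ^ k ≤ levelScale η T k := by
  induction k with
  | zero => simp [levelScale, rotCount]
  | succ k ih =>
    have := (levelScale_succ_bounds h1 h2 T k).1
    rw [pow_succ]
    linarith

theorem exists_level {η : ℝ} (h1 : 0.8 < η) (h2 : η < 0.82) (T : ℕ → Bool) (K : ℕ) :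
    ∀ᶠ r : ℕ in atTop, ∃ k, K ≤ k ∧ levelScale η T k ≤ r ∧ (r : ℝ) < levelScale η T (k + 1) := by
  classical
  filter_upwards [eventually_ge_atTop ⌈levelScale η T K⌉₊] with r hr
  have hrK : levelScale η T K ≤ r := (Nat.le_ceil _).trans (by exact_mod_cast hr)
  have hle : ∀ k : ℕ, levelScale η T k ≤ r → k ≤ r := by
    intro k hk
    have := (two_pow_le_levelScale h1 h2 T k).trans hk
    have h3 : 2 ^ k ≤ r := by exact_mod_cast this
    exact (Nat.lt_two_pow_self).le.trans h3
  refine ⟨Nat.findGreatest (fun k => levelScale η T k ≤ r) r,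
    Nat.le_findGreatest (hle K hrK) hrK,
    Nat.findGreatest_spec (P := fun k => levelScale η T k ≤ r) (hle K hrK) hrK, ?_⟩
  by_contra! h
  exact Nat.not_succ_le_self _
    (Nat.le_findGreatest (P := fun k => levelScale η T k ≤ r) (hle _ h) h)

theorem exists_radius {η : ℝ} (h1 : 0.8 < η) (h2 : η < 0.82) (T : ℕ → Bool) (k : ℕ) :
    ∃ r : ℕ, k ≤ r ∧ levelScale η T k ≤ r ∧ (r : ℝ) < levelScale η T (k + 1) := by
  have h3 := two_pow_le_levelScale h1 h2 T k
  have h4 : (1 : ℝ) ≤ 2 ^ k := one_le_pow₀ (by norm_num)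
  refine ⟨⌈levelScale η T k⌉₊, ?_, Nat.le_ceil _, ?_⟩
  · have : (2 ^ k : ℝ) ≤ ⌈levelScale η T k⌉₊ := h3.trans (Nat.le_ceil _)
    have h5 : 2 ^ k ≤ ⌈levelScale η T k⌉₊ := by exact_mod_cast this
    exact (Nat.lt_two_pow_self).le.trans h5
  · have := Nat.ceil_lt_add_one (levelScale_pos (by linarith : 0 < η) T k).le
    linarith [(levelScale_succ_bounds h1 h2 T k).1]

theorem exists_abs_loglog_sub_le {η : ℝ} (h1 : 0.8 < η) (h2 : η < 0.82) {T : ℕ → Bool} {b : ℕ → ℕ}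
    (hU : ∃ C : ℝ, 0 < C ∧ ∀ k r : ℕ, Real.log (b r) ≤
      C * 4 ^ changeCount T k * (η ^ rotCount T k * r + 2 ^ k))
    (hL : ∃ C : ℝ, 0 < C ∧ ∀ k r : ℕ, C * 4 ^ changeCount T k * (2 ^ k / η ^ rotCount T k) ≤ r →
      2 ^ k * Real.log 2 ≤ Real.log (b r)) :
    ∃ (A : ℝ) (c : ℕ), 0 ≤ A ∧ ∀ k r : ℕ, 2 * changeCount T k + c ≤ k → levelScale η T k ≤ r →
      (r : ℝ) < levelScale η T (k + 1) →
      |Real.log (Real.log (b r)) - k * Real.log 2| ≤ A * (changeCount T k + 1) := by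
  obtain ⟨C, hC, hU⟩ := hU
  obtain ⟨D, hD, hL⟩ := hL
  obtain ⟨c, hc⟩ := pow_unbounded_of_one_lt D (by norm_num : (1 : ℝ) < 2)
  have hlog2 : 0 < Real.log 2 := Real.log_pos (by norm_num)
  have hlog4 : Real.log 4 = 2 * Real.log 2 := by
    rw [show (4 : ℝ) = 2 ^ 2 by norm_num, Real.log_pow]
    norm_num
  refine ⟨|Real.log (4 * C)| + 2 * Real.log 2 + c * Real.log 2 + |Real.log (Real.log 2)|, c,
    by positivity, fun k r hk hr hr' => ?_⟩
  have hη0 : 0 < η := by linarith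
  set M := changeCount T k with hM
  have hN : 0 < η ^ rotCount T k := by positivity
  -- lower bound
  obtain ⟨k', hk'⟩ : ∃ k', k = k' + (2 * M + c) := ⟨k - (2 * M + c), by omega⟩
  have hlow : 2 ^ k' * Real.log 2 ≤ Real.log (b r) := by
    refine hL k' r (le_trans ?_ hr)
    have hm : changeCount T k' ≤ M := changeCount_mono T (by omega)
    have hn : η ^ rotCount T k ≤ η ^ rotCount T k' :=
      pow_le_pow_of_le_one hη0.le (by linarith) (rotCount_mono T (by omega))
    have e1 : (4 : ℝ) ^ changeCount T k' ≤ 4 ^ M := pow_le_pow_right₀ (by norm_num) hm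
    have e2 : (2 : ℝ) ^ k' / η ^ rotCount T k' ≤ 2 ^ k' / η ^ rotCount T k :=
      div_le_div_of_nonneg_left (by positivity) hN hn
    have e3 : (2 : ℝ) ^ k = 2 ^ c * 4 ^ M * 2 ^ k' := by
      rw [hk', pow_add, pow_add, pow_mul]
      norm_num
      ring
    rw [levelScale, e3, mul_div_assoc]
    gcongr
  have hlogb : 0 < Real.log (b r) := lt_of_lt_of_le (by positivity) hlow
  have hlow' : k' * Real.log 2 + Real.log (Real.log 2) ≤ Real.log (Real.log (b r)) := by
    have := Real.log_le_log (by positivity) hlow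
    rwa [Real.log_mul (by positivity) hlog2.ne', Real.log_pow] at this
  -- upper bound
  have hup : Real.log (b r) ≤ 4 * C * 4 ^ M * 2 ^ k := by
    refine (hU k r).trans ?_
    have e1 : (r : ℝ) ≤ 3 * levelScale η T k :=
      hr'.le.trans (levelScale_succ_bounds h1 h2 T k).2
    have e2 : η ^ rotCount T k * r ≤ 3 * 2 ^ k := by
      refine (mul_le_mul_of_nonneg_left e1 hN.le).trans (le_of_eq ?_)
      rw [levelScale]
      field_simp
    calc C * 4 ^ M * (η ^ rotCount T k * r + 2 ^ k)
        ≤ C * 4 ^ M * (3 * 2 ^ k + 2 ^ k) := by gcongr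
      _ = _ := by ring
  have hup' : Real.log (Real.log (b r)) ≤
      Real.log (4 * C) + M * Real.log 4 + k * Real.log 2 := by
    have := Real.log_le_log hlogb hup
    rwa [Real.log_mul (by positivity) (by positivity), Real.log_mul (by positivity) (by positivity),
      Real.log_pow, Real.log_pow] at this
  have hkr : (k : ℝ) = k' + (2 * M + c) := by exact_mod_cast hk'
  have hM0 : (0 : ℝ) ≤ M := by positivity
  have a1 := le_abs_self (Real.log (4 * C))
  have a2 := neg_abs_le (Real.log (Real.log 2))
  have a3 := abs_nonneg (Real.log (4 * C))
  have a4 := abs_nonneg (Real.log (Real.log 2))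
  have a5 : 0 ≤ c * Real.log 2 := by positivity
  have a6 : (|Real.log (4 * C)| + c * Real.log 2 + |Real.log (Real.log 2)|) * M ≥ 0 := by positivity
  rw [abs_le]
  constructor
  · rw [hkr]
    nlinarith
  · rw [hlog4] at hup'
    nlinarith

theorem abs_div_sub_div_le {X Y x y A B d : ℝ} (hd : 0 < d) (hx : 0 ≤ x) (hxy : x ≤ y) (hdy : d ≤ y)
    (hX : |X - x| ≤ A) (hY : y ≤ Y) (hYB : Y ≤ y + B) : |X / Y - x / y| ≤ (A + B) / d := by
  have hy : 0 < y := hd.trans_le hdy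
  have hY0 : 0 < Y := hy.trans_le hY
  have e : X / Y - x / y = (X - x) / Y - (x / y) * ((Y - y) / Y) := by
    field_simp
    ring
  have hA : 0 ≤ A := (abs_nonneg _).trans hX
  have hB : 0 ≤ B := by linarith
  have h1 : |(X - x) / Y| ≤ A / d := by
    rw [abs_div, abs_of_pos hY0]
    exact div_le_div₀ hA hX hd (hdy.trans hY)
  have h2 : |(x / y) * ((Y - y) / Y)| ≤ B / d := by
    rw [abs_of_nonneg (mul_nonneg (div_nonneg hx hy.le) (div_nonneg (by linarith) hY0.le))]
    calc (x / y) * ((Y - y) / Y) ≤ 1 * ((Y - y) / Y) :=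
          mul_le_mul_of_nonneg_right ((div_le_one hy).2 hxy) (div_nonneg (by linarith) hY0.le)
      _ ≤ B / d := by
          rw [one_mul]
          exact div_le_div₀ hB (by linarith) hd (hdy.trans hY)
  rw [e, add_div]
  exact (abs_sub _ _).trans (add_le_add h1 h2)

/-- The growth exponent that belongs to the density `x` of rotating places. -/
noncomputable def densityExponent (η x : ℝ) : ℝ := Real.log 2 / (Real.log 2 - x * Real.log η)

theorem tendsto_sqrt_div : Tendsto (fun k : ℕ => ((k.sqrt : ℝ) + 1) / k) atTop (𝓝 0) := by
  have h1 : Tendsto (fun k : ℕ => 2 / Real.sqrt k) atTop (𝓝 0) :=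
    tendsto_const_nhds.div_atTop (Real.tendsto_sqrt_atTop.comp tendsto_natCast_atTop_atTop)
  refine squeeze_zero' (Eventually.of_forall fun k => by positivity) ?_ h1
  filter_upwards [eventually_ge_atTop 1] with k hk
  have hk' : (1 : ℝ) ≤ k := by exact_mod_cast hk
  have hs : 1 ≤ Real.sqrt k := Real.one_le_sqrt.2 hk'
  have h2 : (k.sqrt : ℝ) ≤ Real.sqrt k := Real.nat_sqrt_le_real_sqrt
  rw [div_le_div_iff₀ (by linarith) (by linarith)]
  nlinarith [Real.mul_self_sqrt (by linarith : (0 : ℝ) ≤ k)]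

/-- The numerator is known up to O(√k) and the denominator up to log 3, while the denominator is at
least k log 2. -/
theorem eventually_abs_ratio_sub_le {η : ℝ} (h1 : 0.8 < η) (h2 : η < 0.82) {T : ℕ → Bool}
    (hT : ∀ k, changeCount T k ≤ 2 * k.sqrt + 1) {b : ℕ → ℕ}
    (hU : ∃ C : ℝ, 0 < C ∧ ∀ k r : ℕ, Real.log (b r) ≤
      C * 4 ^ changeCount T k * (η ^ rotCount T k * r + 2 ^ k))
    (hL : ∃ C : ℝ, 0 < C ∧ ∀ k r : ℕ, C * 4 ^ changeCount T k * (2 ^ k / η ^ rotCount T k) ≤ r →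
      2 ^ k * Real.log 2 ≤ Real.log (b r)) {ε : ℝ} (hε : 0 < ε) :
    ∀ᶠ k : ℕ in atTop, ∀ r : ℕ, levelScale η T k ≤ r → (r : ℝ) < levelScale η T (k + 1) →
      |Real.log (Real.log (b r)) / Real.log r - densityExponent η (rotCount T k / k)| ≤ ε := by
  obtain ⟨A, c, hA, h⟩ := exists_abs_loglog_sub_le h1 h2 hU hL
  have hlog2 : 0 < Real.log 2 := Real.log_pos (by norm_num)
  have hη : 0 < η := by linarith
  have hlogη : Real.log η < 0 := Real.log_neg hη (by linarith)
  have ht := tendsto_sqrt_div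
  have ev1 : ∀ᶠ k : ℕ in atTop, ((k.sqrt : ℝ) + 1) / k < 1 / (4 + c) :=
    ht.eventually_lt_const (by positivity)
  have ev2 : ∀ᶠ k : ℕ in atTop, ((k.sqrt : ℝ) + 1) / k <
      ε * Real.log 2 / (2 * A + Real.log 3) := by
    refine ht.eventually_lt_const (div_pos (by positivity) ?_)
    have : 0 < Real.log 3 := Real.log_pos (by norm_num)
    positivity
  filter_upwards [ev1, ev2, eventually_ge_atTop 1] with k e1 e2 hk1 r hr hr'
  have hk0 : (0 : ℝ) < k := by exact_mod_cast hk1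
  have hTk : (changeCount T k : ℝ) ≤ 2 * k.sqrt + 1 := by exact_mod_cast hT k
  have hlog3 : 0 < Real.log 3 := Real.log_pos (by norm_num)
  rw [div_lt_div_iff₀ hk0 (by positivity)] at e1
  rw [div_lt_div_iff₀ hk0 (by positivity)] at e2
  have hs : (0 : ℝ) ≤ k.sqrt := by positivity
  have hc : (0 : ℝ) ≤ c := by positivity
  have hk : 2 * changeCount T k + c ≤ k := by
    have : (2 * changeCount T k + c : ℝ) ≤ k := by nlinarith
    exact_mod_cast this
  have hX := h k r hk hr hr'
  have hpos := levelScale_pos hη T k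
  have hr0 : (0 : ℝ) < r := hpos.trans_le hr
  have hY := Real.log_le_log hpos hr
  have hY' : Real.log r ≤ Real.log (levelScale η T k) + Real.log 3 := by
    rw [← Real.log_mul hpos.ne' (by norm_num), mul_comm]
    exact Real.log_le_log hr0 (hr'.le.trans (levelScale_succ_bounds h1 h2 T k).2)
  have hn0 : (0 : ℝ) ≤ rotCount T k := by positivity
  have hxy : k * Real.log 2 ≤ Real.log (levelScale η T k) := by
    rw [log_levelScale hη]
    nlinarith
  have key := abs_div_sub_div_le (d := k * Real.log 2) (by positivity) (by positivity) hxy hxy hX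
    hY hY'
  have e : k * Real.log 2 / Real.log (levelScale η T k) =
      densityExponent η (rotCount T k / k) := by
    rw [log_levelScale hη, densityExponent]
    have : k * Real.log 2 - rotCount T k * Real.log η =
        k * (Real.log 2 - rotCount T k / k * Real.log η) := by field_simp
    rw [this, mul_div_mul_left _ _ hk0.ne']
  rw [e] at key
  refine key.trans ?_
  rw [div_le_iff₀ (by positivity)]
  have hA' : A * (changeCount T k + 1) ≤ A * (2 * (k.sqrt + 1)) :=
    mul_le_mul_of_nonneg_left (by linarith) hA
  have : Real.log 3 ≤ Real.log 3 * (k.sqrt + 1) := by nlinarith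
  nlinarith

theorem densityExponent_antitone {η : ℝ} (h0 : 0 < η) (h1 : η < 1) {x y : ℝ}
    (hx : 0 ≤ x) (hxy : x ≤ y) : densityExponent η y ≤ densityExponent η x := by
  have hlog2 : 0 < Real.log 2 := Real.log_pos (by norm_num)
  have hlogη : Real.log η < 0 := Real.log_neg h0 h1
  unfold densityExponent
  refine div_le_div_of_nonneg_left hlog2.le ?_ ?_ <;> nlinarith

theorem continuousAt_densityExponent {η : ℝ} (h0 : 0 < η) (h1 : η < 1) {x : ℝ} (hx : 0 ≤ x) :
    ContinuousAt (densityExponent η) x := by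
  have hlog2 : 0 < Real.log 2 := Real.log_pos (by norm_num)
  have hlogη : Real.log η < 0 := Real.log_neg h0 h1
  unfold densityExponent
  refine ContinuousAt.div continuousAt_const (by fun_prop) ?_
  have : 0 < Real.log 2 - x * Real.log η := by nlinarith
  exact this.ne'

/-- The exponent decreases with the density, so the upper density `q` gives the lower limit and `p`
the upper one. Every large radius lies between two consecutive level scales, and every level is met
by some radius. -/
theorem liminf_limsup_ratio {η : ℝ} (h1 : 0.8 < η) (h2 : η < 0.82) {p q : ℝ} (hp : 0 ≤ p)
    (hpq : p ≤ q) {T : ℕ → Bool}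
    (hT : ∀ k, changeCount T k ≤ 2 * k.sqrt + 1)
    (hTb : ∀ k : ℕ, p * k - 3 * (k.sqrt + 1) ≤ rotCount T k ∧
        (rotCount T k : ℝ) ≤ q * k + 3 * (k.sqrt + 1))
    (hTp : ∀ K : ℕ, ∃ k : ℕ, K ≤ k ∧ (rotCount T k : ℝ) ≤ p * k + 3 * (k.sqrt + 1))
    (hTq : ∀ K : ℕ, ∃ k : ℕ, K ≤ k ∧ q * k - 3 * (k.sqrt + 1) ≤ (rotCount T k : ℝ))
    {b : ℕ → ℕ}
    (hU : ∃ C : ℝ, 0 < C ∧ ∀ k r : ℕ, Real.log (b r) ≤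
      C * 4 ^ changeCount T k * (η ^ rotCount T k * r + 2 ^ k))
    (hL : ∃ C : ℝ, 0 < C ∧ ∀ k r : ℕ, C * 4 ^ changeCount T k * (2 ^ k / η ^ rotCount T k) ≤ r →
      2 ^ k * Real.log 2 ≤ Real.log (b r)) :
    liminf (fun r : ℕ => ((Real.log (Real.log (b r)) / Real.log r : ℝ) : EReal)) atTop =
        (densityExponent η q : EReal) ∧
      limsup (fun r : ℕ => ((Real.log (Real.log (b r)) / Real.log r : ℝ) : EReal)) atTop =
        (densityExponent η p : EReal) := by
  have h0 : 0 < η := by linarith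
  have h1' : η < 1 := by linarith
  set g := densityExponent η with hg
  have hq : 0 ≤ q := hp.trans hpq
  have hanti := fun x y : ℝ => densityExponent_antitone (x := x) (y := y) h0 h1'
  have hdens : ∀ δ : ℝ, 0 < δ → ∀ᶠ k : ℕ in atTop, 0 < (k : ℝ) ∧ 3 * ((k.sqrt : ℝ) + 1) ≤ δ * k := by
    intro δ hδ
    filter_upwards [tendsto_sqrt_div.eventually_lt_const (by positivity : (0 : ℝ) < δ / 3),
      eventually_ge_atTop 1] with k hk hk1
    have hk0 : (0 : ℝ) < k := by exact_mod_cast hk1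
    rw [div_lt_iff₀ hk0] at hk
    exact ⟨hk0, by linarith⟩
  have hnn : ∀ k : ℕ, (0 : ℝ) ≤ rotCount T k / k := fun k => by positivity
  -- uniform lower and upper bounds for the exponents of the levels
  have hlowk : ∀ ε : ℝ, 0 < ε → ∃ δ : ℝ, 0 < δ ∧ ∀ x, 0 ≤ x →
      (x ≤ q + δ → g q - ε ≤ g x) ∧ (q - δ ≤ x → g x ≤ g q + ε) ∧
      (x ≤ p + δ → g p - ε ≤ g x) ∧ (p - δ ≤ x → g x ≤ g p + ε) := by
    intro ε hε
    have main : ∀ s : ℝ, 0 ≤ s → ∃ δ : ℝ, 0 < δ ∧ ∀ x, 0 ≤ x →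
        (x ≤ s + δ → g s - ε ≤ g x) ∧ (s - δ ≤ x → g x ≤ g s + ε) := by
      intro s hs
      obtain ⟨δ, hδ, h⟩ := Metric.continuousAt_iff.1 (continuousAt_densityExponent h0 h1' hs) ε hε
      refine ⟨δ / 2, by positivity, fun x hx => ⟨fun hxs => ?_, fun hxs => ?_⟩⟩
      · rcases le_total x s with hle | hle
        · linarith [hanti x s hx hle]
        · have := h (x := x) (by rw [Real.dist_eq, abs_of_nonneg (by linarith)]; linarith)
          rw [Real.dist_eq, abs_lt] at this
          linarith [this.1]
      · rcases le_total s x with hle | hle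
        · linarith [hanti s x hs hle]
        · have := h (x := x) (by rw [Real.dist_eq, abs_of_nonpos (by linarith)]; linarith)
          rw [Real.dist_eq, abs_lt] at this
          linarith [this.2]
    obtain ⟨δ₁, hδ₁, m1⟩ := main q hq
    obtain ⟨δ₂, hδ₂, m2⟩ := main p hp
    refine ⟨min δ₁ δ₂, lt_min hδ₁ hδ₂, fun x hx => ?_⟩
    have l1 := min_le_left δ₁ δ₂
    have l2 := min_le_right δ₁ δ₂
    exact ⟨fun h => (m1 x hx).1 (by linarith), fun h => (m1 x hx).2 (by linarith),
      fun h => (m2 x hx).1 (by linarith), fun h => (m2 x hx).2 (by linarith)⟩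
  set f : ℕ → ℝ := fun r => Real.log (Real.log (b r)) / Real.log r with hf
  have hev : ∀ ε : ℝ, 0 < ε → ∀ᶠ r in atTop, g q - ε ≤ f r ∧ f r ≤ g p + ε := by
    intro ε hε
    obtain ⟨δ, hδ, hgδ⟩ := hlowk (ε / 2) (by positivity)
    obtain ⟨K, hK⟩ := eventually_atTop.1 ((eventually_abs_ratio_sub_le h1 h2 hT hU hL
      (by positivity : 0 < ε / 2)).and (hdens δ hδ))
    filter_upwards [exists_level h1 h2 T K] with r hr
    obtain ⟨k, hk, hr1, hr2⟩ := hr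
    obtain ⟨a, hk0, d⟩ := hK k hk
    have a := abs_le.1 (a r hr1 hr2)
    have t := hTb k
    have u := hgδ _ (hnn k)
    have u1 := u.1 (by rw [div_le_iff₀ hk0]; linarith)
    have u2 := u.2.2.2 (by rw [le_div_iff₀ hk0]; linarith)
    constructor <;> linarith [a.1, a.2]
  have hfr : ∀ ε : ℝ, 0 < ε → (∃ᶠ r in atTop, f r ≤ g q + ε) ∧ ∃ᶠ r in atTop, g p - ε ≤ f r := by
    intro ε hε
    obtain ⟨δ, hδ, hgδ⟩ := hlowk (ε / 2) (by positivity)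
    obtain ⟨K, hK⟩ := eventually_atTop.1 ((eventually_abs_ratio_sub_le h1 h2 hT hU hL
      (by positivity : 0 < ε / 2)).and (hdens δ hδ))
    constructor
    · refine frequently_atTop.2 fun R => ?_
      obtain ⟨k, hk, t⟩ := hTq (max K R)
      obtain ⟨r, hkr, hr1, hr2⟩ := exists_radius h1 h2 T k
      obtain ⟨a, hk0, d⟩ := hK k ((le_max_left _ _).trans hk)
      have a := abs_le.1 (a r hr1 hr2)
      have u := (hgδ _ (hnn k)).2.1 (by rw [le_div_iff₀ hk0]; linarith)
      exact ⟨r, ((le_max_right _ _).trans hk).trans hkr, by linarith [a.2]⟩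
    · refine frequently_atTop.2 fun R => ?_
      obtain ⟨k, hk, t⟩ := hTp (max K R)
      obtain ⟨r, hkr, hr1, hr2⟩ := exists_radius h1 h2 T k
      obtain ⟨a, hk0, d⟩ := hK k ((le_max_left _ _).trans hk)
      have a := abs_le.1 (a r hr1 hr2)
      have u := (hgδ _ (hnn k)).2.2.1 (by rw [div_le_iff₀ hk0]; linarith)
      exact ⟨r, ((le_max_right _ _).trans hk).trans hkr, by linarith [a.1]⟩
  constructor
  · apply le_antisymm
    · rw [← EReal.le_of_forall_lt_iff_le]
      intro z hz
      have hz' : g q < z := EReal.coe_lt_coe_iff.1 hz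
      refine liminf_le_of_frequently_le' ((hfr (z - g q) (by linarith)).1.mono fun r hr => ?_)
      exact EReal.coe_le_coe_iff.2 (by linarith)
    · rw [← EReal.ge_of_forall_gt_iff_ge]
      intro z hz
      have hz' : z < g q := EReal.coe_lt_coe_iff.1 hz
      refine le_liminf_of_le (by isBoundedDefault) ((hev (g q - z) (by linarith)).mono
        fun r hr => ?_)
      exact EReal.coe_le_coe_iff.2 (by linarith [hr.1])
  · apply le_antisymm
    · rw [← EReal.le_of_forall_lt_iff_le]
      intro z hz
      have hz' : g p < z := EReal.coe_lt_coe_iff.1 hz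
      refine limsup_le_of_le (by isBoundedDefault) ((hev (z - g p) (by linarith)).mono
        fun r hr => ?_)
      exact EReal.coe_le_coe_iff.2 (by linarith [hr.2])
    · rw [← EReal.ge_of_forall_gt_iff_ge]
      intro z hz
      have hz' : z < g p := EReal.coe_lt_coe_iff.1 hz
      refine le_limsup_of_frequently_le' ((hfr (g p - z) (by linarith)).2.mono fun r hr => ?_)
      exact EReal.coe_le_coe_iff.2 (by linarith)

/-! ### Prescribing the exponents -/

theorem exists_hasLogGrowthExponents.{u} {η : ℝ} (hη : η ^ 3 + η ^ 2 + η - 2 = 0) {α β : ℝ}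
    (hα : Real.log 2 / (Real.log 2 - Real.log η) ≤ α) (hαβ : α ≤ β) (hβ : β ≤ 1) :
    ∃ ω : ℕ → Fin 3, ∀ (F : Type u) [Group F] [Finite F] [Nontrivial F],
      HasLogGrowthExponents (grigorchukWreath F ω) α β := by
  obtain ⟨h1, h2⟩ := eta_bounds hη
  have hlog2 : 0 < Real.log 2 := Real.log_pos (by norm_num)
  have hlogη : Real.log η < 0 := Real.log_neg (by linarith) (by linarith)
  have hα0 : 0 < α := lt_of_lt_of_le (div_pos hlog2 (by linarith)) hα
  have hβ0 : 0 < β := hα0.trans_le hαβ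
  -- This inverts `densityExponent` and reverses the order: exponent 1 corresponds to density 0 and
  -- α₀ to density 1.
  set d : ℝ → ℝ := fun x => (Real.log 2 / x - Real.log 2) / (-Real.log η) with hd
  have hgd : ∀ x, 0 < x → densityExponent η (d x) = x := by
    intro x hx
    have : Real.log 2 - d x * Real.log η = Real.log 2 / x := by
      simp only [hd]
      field_simp [hlogη.ne]
      ring
    rw [densityExponent, this]
    field_simp
  have hp : 0 ≤ d β := by
    refine div_nonneg (sub_nonneg.2 ?_) (by linarith)
    rw [le_div_iff₀ hβ0]
    nlinarith
  have hpq : d β ≤ d α := by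
    refine div_le_div_of_nonneg_right (sub_le_sub_right ?_ _) (by linarith)
    exact div_le_div_of_nonneg_left hlog2.le hα0 hαβ
  have hq : d α ≤ 1 := by
    refine (div_le_one (by linarith)).2 ?_
    rw [div_le_iff₀ (by linarith)] at hα
    rw [sub_le_iff_le_add, div_le_iff₀ hα0]
    linarith
  obtain ⟨T, hT, hTb, hTp, hTq⟩ := exists_mode_densities hp hpq hq
  refine ⟨modeSeq T 0, fun F _ _ _ => ⟨fg_grigorchukWreath _, fun S hS hgen => ?_⟩⟩
  have := liminf_limsup_ratio h1 h2 hp hpq hT hTb hTp hTq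
    (exists_log_growthFunction_le hη T hS) (exists_le_log_growthFunction hη T hS hgen)
  rwa [hgd α hα0, hgd β hβ0] at this

end GrigorchukGrowth

theorem mainTheorem1 (η : ℝ) (hη : η ^ 3 + η ^ 2 + η - 2 = 0) :
    (∀ α β : ℝ, Real.log 2 / (Real.log 2 - Real.log η) ≤ α → α ≤ β → β ≤ 1 →
      ∃ ω : ℕ → Fin 3, ∀ (F : Type*) [Group F] [Finite F] [Nontrivial F],
        HasLogGrowthExponents (grigorchukWreath F ω) α β) ∧
    (∀ α : ℝ, Real.log 2 / (Real.log 2 - Real.log η) ≤ α → α ≤ 1 →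
      ∃ ω : ℕ → Fin 3, ∀ (F : Type*) [Group F] [Finite F] [Nontrivial F],
        HasLogGrowthExponent (grigorchukWreath F ω) α) := by
  refine ⟨fun α β hα hαβ hβ => GrigorchukGrowth.exists_hasLogGrowthExponents hη hα hαβ hβ,
    fun α hα hα1 => ?_⟩
  obtain ⟨ω, hω⟩ := GrigorchukGrowth.exists_hasLogGrowthExponents hη hα le_rfl hα1
  refine ⟨ω, fun F _ _ _ => ⟨(hω F).1, fun S hS hgen => ?_⟩⟩
  obtain ⟨h1, h2⟩ := (hω F).2 S hS hgen
  exact EReal.tendsto_coe.1 (tendsto_of_liminf_eq_limsup h1 h2)
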